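/- **Theorem 3.3.** Let $g\ge 1$ and let $\mathcal P(x)=\lambda_0x^{2g+1}+\sum_{n=0}^{2g}\lambda_{4g+2-2n}x^n\in\mathbb C[x]$, $\lambda_0=1$, have no multiple roots, so that $y^2=\mathcal P(x)$ defines a hyperelliptic curve of genus $g$ with one point $\infty$ at infinity and involution $\iota(x,y)=(x,-y)$. A finite sum of finite points of the curve is called *non-special* if, after deleting all pairs $Q+\iota Q$ from it (for a branch point $Q=\iota Q$, pairs $2Q$), a sum of at least $g$ points remains. Let $P_k=(x_k,y_k)$, $k=1,\dots,g$, be distinct finite points of the curve such that $D_{g+1}=2P_1+\sum_{k=2}^gP_k$ is non-special. Then there is an effective divisor $\widetilde D$ of degree $g$ with $\widetilde D-g\infty$ linearly equivalent to $D_{g+1}-(g+1)\infty$, and every such $\widetilde D$ is defined by the system $$\mathcal H(x)=0,\qquad y=-\mathcal I(x),$$ that is, $\widetilde D$ does not contain $\infty$ and consists of the common zeros, counted with multiplicity, of the functions $\mathcal H(x)$ and $y+\mathcal I(x)$ on the finite part of the curve (the multiplicity at a point is the smaller of the two orders of vanishing). Here $\mathcal H$ is a monic polynomial of degree $g$, $\mathcal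 I$ is a polynomial of degree at most $g-1$, and $$\begin{aligned} \mathcal H(x)={}&\sum_{n=0}^g x^n\sum_{j=0}^{g-n}\lambda_{2g-2n-2j}\,h_j\big|_{x_{g+1}=x_1}\\ &-\frac{\mathcal P'(x_1)}{\prod_{i=2}^g(x_1-x_i)^2}\Bigg(\frac{\prod_{i=2}^g(x-x_i)-\prod_{i=2}^g(x_1-x_i)}{x-x_1}-\prod_{i=2}^g(x-x_i)\sum_{\iota=2}^g\frac1{x_1-x_\iota}\Bigg)\\ &-\frac{\mathcal P'(x_1)}{2y_1\prod_{i=2}^g(x_1-x_i)}\Bigg(\sum_{k=2}^g\frac{2y_k\prod_{i=1,\,i\ne k}^g(x-x_i)}{(x_k-x_1)\prod_{i=1,\,i\ne k}^g(x_k-x_i)}+\frac{\mathcal P'(x_1)}{2y_1}\prod_{i=2}^g\frac{x-x_i}{x_1-x_i}\Bigg)\\ &+\sum_{j=2}^g\frac{(y_1-y_j)^2\prod_{i=2,\,i\ne j}^g(x-x_i)}{(x_j-x_1)\prod_{i=1,\,i\ne j}^g(x_j-x_i)\prod_{i=2}^g(x_1-x_i)}\Bigg(1-(x-x_1)\sum_{\iota=2}^g\frac1{x_1-x_\iota}\Bigg)\\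 &+\sum_{\substack{k,j=2\\k\ne j}}^g\frac{(y_k^2-y_ky_j)(x-x_1)^2\prod_{i=2,\,i\ne k,j}^g(x-x_i)}{(x_k-x_1)(x_j-x_1)\prod_{i=1,\,i\ne k}^g(x_k-x_i)\prod_{i=1,\,i\ne j}^g(x_j-x_i)}, \end{aligned}$$ $$\begin{aligned} \mathcal I(x)={}&\frac{(x-x_1)\prod_{i=2}^g(x-x_i)-\mathcal H(x)}{\prod_{i=2}^g(x_1-x_i)}\Bigg(\frac{\mathcal P'(x_1)}{2y_1}-y_1\sum_{\iota=2}^g\frac1{x_1-x_\iota}\Bigg)+y_1\prod_{i=2}^g\frac{x-x_i}{x_1-x_i}\\ &+\sum_{k=2}^gy_k\,\frac{(x-x_1)\prod_{i=1,\,i\ne k}^g(x-x_i)-\mathcal H(x)}{(x_k-x_1)\prod_{i=1,\,i\ne k}^g(x_k-x_i)}, \end{aligned}$$ where $h_j$ is the complete symmetric polynomial of degree $j$ in $x_1,\dots,x_{g+1}$. -/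

import Mathlib

open Polynomial

noncomputable section

namespace HyperellipticReduction

/-- The polynomial `λ₀ x^(2g+1) + ∑_{n=0}^{2g} λ_{4g+2-2n} x^n`; the curve is `y² = 𝒫(x)`. -/
def curvePoly (g : ℕ) (lam : ℕ → ℂ) : ℂ[X] :=
  C (lam 0) * X ^ (2 * g + 1) +
    ∑ n ∈ Finset.range (2 * g + 1), C (lam (4 * g + 2 - 2 * n)) * X ^ n

/-- The finite points `(x, y)` of the curve `y² = P(x)`. -/
@[ext]
structure AffPoint (P : ℂ[X]) where
  x : ℂ
  y : ℂ
  on_curve : y ^ 2 = P.eval x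

variable {P : ℂ[X]}

/-- The hyperelliptic involution `(x, y) ↦ (x, -y)`. -/
def AffPoint.invol (Q : AffPoint P) : AffPoint P where
  x := Q.x
  y := -Q.y
  on_curve := by rw [neg_sq]; exact Q.on_curve

/-- The points of the complete curve: the finite points (`some Q`) and the point at
infinity (`none`). -/
abbrev CurvePoint (P : ℂ[X]) : Type := Option (AffPoint P)

/-- The point at infinity. -/
abbrev infPt (P : ℂ[X]) : CurvePoint P := none

/-- Divisors on the complete curve. -/
abbrev Divisor (P : ℂ[X]) : Type := CurvePoint P →₀ ℤ

/-- The degree of a divisor. -/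
def Divisor.deg (D : Divisor P) : ℤ := D.sum fun _ m => m

/-- A formal sum of finite points (a multiset) as a divisor on the complete curve. -/
def toDivisor (D : Multiset (AffPoint P)) : Divisor P :=
  (D.map fun Q => Finsupp.single (some Q) (1 : ℤ)).sum

/-- The multiple `n ∞` of the point at infinity, as a divisor. -/
def infDiv (P : ℂ[X]) (n : ℤ) : Divisor P := Finsupp.single (infPt P) n

/-- The coordinate ring `ℂ[x, y] / (y² - P(x))` of the finite part of the curve. -/
abbrev CoordRing (P : ℂ[X]) : Type := AdjoinRoot (X ^ 2 - C P : ℂ[X][X])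

/-- The function `a(x) + b(x) y` on the curve. Every polynomial function in `x` and `y` has
exactly one such form. -/
def regFun (P a b : ℂ[X]) : CoordRing P :=
  AdjoinRoot.of (X ^ 2 - C P) a +
    AdjoinRoot.of (X ^ 2 - C P) b * AdjoinRoot.root (X ^ 2 - C P)

/-- The maximal ideal `(x - x_Q, y - y_Q)` of functions vanishing at the finite point `Q`. -/
def maxIdeal (Q : AffPoint P) : Ideal (CoordRing P) :=
  Ideal.span {regFun P (X - C Q.x) 0, regFun P (-C Q.y) 1}

/-- The order of vanishing at a finite point `Q` of a nonzero polynomial function `u`: the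
largest `n` with `u ∈ 𝔪_Q ^ n`. (The value at `u = 0` is never used.) -/
def ordAt (Q : AffPoint P) (u : CoordRing P) : ℕ := sSup {n : ℕ | u ∈ maxIdeal Q ^ n}

/-- The order of the pole at infinity (the Sato weight) of the nonzero function
`a(x) + b(x) y`, where `x` has a pole of order `2` and `y` one of order `deg P = 2g+1`. -/
def poleOrder (P a b : ℂ[X]) : ℕ :=
  if b = 0 then 2 * a.natDegree else max (2 * a.natDegree) (2 * b.natDegree + P.natDegree)

/-- `D` is the divisor of a rational function `(a + b y) / (c + d y)` on the complete curve. -/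
def IsPrincipal (D : Divisor P) : Prop :=
  ∃ a b c d : ℂ[X], regFun P a b ≠ 0 ∧ regFun P c d ≠ 0 ∧
    (∀ Q : AffPoint P,
      D (some Q) = (ordAt Q (regFun P a b) : ℤ) - (ordAt Q (regFun P c d) : ℤ)) ∧
    D (infPt P) = (poleOrder P c d : ℤ) - (poleOrder P a b : ℤ)

/-- Linear equivalence of divisors. -/
def LinEquiv (D D' : Divisor P) : Prop := IsPrincipal (D - D')

/-- `T` is the truncated version of `D`: it is what remains after deleting from `D` pairs of
points `Q, ι Q` in involution, and contains no such pair itself. (For a branch point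
`Q = ι Q` the pair is `2 Q`.) -/
def IsTruncation (D T : Multiset (AffPoint P)) : Prop :=
  (∃ E : Multiset (AffPoint P), D = T + (E + E.map AffPoint.invol)) ∧
    ∀ Q : AffPoint P, ¬ ({Q, Q.invol} : Multiset (AffPoint P)) ≤ T

/-- A finite sum of points on a curve of genus `g` is non-special if its truncated version has
degree at least `g`. -/
def NonSpecial (g : ℕ) (D : Multiset (AffPoint P)) : Prop :=
  ∃ T : Multiset (AffPoint P), IsTruncation D T ∧ g ≤ Multiset.card T

/-- `D'` is a divisor of degree `g` (an effective one, a sum of `g` points, possibly at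
infinity) with `D' - g ∞` equivalent to `D - (deg D) ∞`. -/
def IsReductionOf (g : ℕ) (D : Multiset (AffPoint P)) (D' : Divisor P) : Prop :=
  0 ≤ D' ∧ D'.deg = g ∧
    LinEquiv (D' - infDiv P g) (toDivisor D - infDiv P (Multiset.card D))

/-- `D` is the divisor defined by the system `H(x) = 0`, `y = J(x)`: it consists of the
common zeros of the functions `H(x)` and `y - J(x)` on the finite part of the curve, each taken
with its multiplicity as a common zero. -/
def DefinedBySystem (D : Divisor P) (H J : ℂ[X]) : Prop :=
  H ≠ 0 ∧ D (infPt P) = 0 ∧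
    ∀ Q : AffPoint P,
      D (some Q) = (min (ordAt Q (regFun P H 0)) (ordAt Q (regFun P (-J) 1)) : ℕ)

section Formulas

variable (g : ℕ) [NeZero g] (lam : ℕ → ℂ) (x y : Fin g → ℂ)

/-- The indices `2, …, g` (the points are numbered from `0` here, so `x 0` is `x₁`). -/
def tail : Finset (Fin g) := Finset.univ.erase 0

/-- `∏_{i=2}^g (x - x_i)`. -/
def tailPoly : ℂ[X] := ∏ i ∈ tail g, (X - C (x i))

/-- The number `∏_{i=2}^g (x₁ - x_i)`. -/
def tailProd : ℂ := ∏ i ∈ tail g, (x 0 - x i)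

/-- The number `∏_{i=1, i≠k}^g (x_k - x_i)`. -/
def nodeProd (k : Fin g) : ℂ := ∏ i ∈ Finset.univ.erase k, (x k - x i)

/-- `∑_{i=2}^g (x₁ - x_i)⁻¹`. -/
def invSum : ℂ := ∑ i ∈ tail g, (x 0 - x i)⁻¹

/-- `h_j` restricted to `x_{g+1} = x₁`, where `h_j` is the complete symmetric polynomial of
degree `j` in `x₁, …, x_{g+1}`. -/
def hDoubled (j : ℕ) : ℂ :=
  MvPolynomial.aeval (Fin.snoc x (x 0) : Fin (g + 1) → ℂ)
    (MvPolynomial.hsymm (Fin (g + 1)) ℂ j)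

/-- `𝒫'(x₁)`. -/
def derivAt : ℂ := (derivative (curvePoly g lam)).eval (x 0)

/-- The polynomial `ℋ`. The polynomial division by `x - x₁` in the second summand is exact. -/
def redH : ℂ[X] :=
  ∑ n ∈ Finset.range (g + 1),
      X ^ n * C (∑ j ∈ Finset.range (g - n + 1), lam (2 * g - 2 * n - 2 * j) * hDoubled g x j)
  - C (derivAt g lam x / tailProd g x ^ 2) *
      ((tailPoly g x - C (tailProd g x)) /ₘ (X - C (x 0)) - tailPoly g x * C (invSum g x))
  - C (derivAt g lam x / (2 * y 0 * tailProd g x)) *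
      (∑ k ∈ tail g,
          C (2 * y k / ((x k - x 0) * nodeProd g x k)) *
            ∏ i ∈ Finset.univ.erase k, (X - C (x i))
        + C (derivAt g lam x / (2 * y 0) / tailProd g x) * tailPoly g x)
  + ∑ j ∈ tail g,
      C ((y 0 - y j) ^ 2 / ((x j - x 0) * nodeProd g x j * tailProd g x)) *
        (∏ i ∈ (tail g).erase j, (X - C (x i))) * (1 - (X - C (x 0)) * C (invSum g x))
  + ∑ k ∈ tail g, ∑ j ∈ (tail g).erase k,
      C ((y k ^ 2 - y k * y j) /
          ((x k - x 0) * (x j - x 0) * nodeProd g x k * nodeProd g x j)) *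
        (X - C (x 0)) ^ 2 * ∏ i ∈ ((tail g).erase k).erase j, (X - C (x i))

/-- The polynomial `ℐ`. -/
def redI : ℂ[X] :=
  C ((derivAt g lam x / (2 * y 0) - y 0 * invSum g x) / tailProd g x) *
      ((X - C (x 0)) * tailPoly g x - redH g lam x y)
  + C (y 0 / tailProd g x) * tailPoly g x
  + ∑ k ∈ tail g,
      C (y k / ((x k - x 0) * nodeProd g x k)) *
        ((X - C (x 0)) * (∏ i ∈ Finset.univ.erase k, (X - C (x i))) - redH g lam x y)

end Formulas

end HyperellipticReduction

end

noncomputable section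

namespace HyperellipticReduction

variable {P : ℂ[X]}

/-! ### Arithmetic of the coordinate ring -/

/-! Non-speciality forces `D` to contain no pair `Q + ιQ`, so `y₁ ≠ 0` and the `x_k` are distinct.
Hence there is a polynomial `a` of degree at most `g` with `a(x_k) = y_k` and `a'(x₁) =
P'(x₁)/(2y₁)`, the slope of the curve at `P₁`: its graph meets the curve along `D`, tangentially at
`P₁`. Let `N = (x - x₁)² ∏_{i≥2} (x - x_i)`. Then `N` divides `P - a²`, which is monic of degree
`2g+1` because `deg a² ≤ 2g`. The quotient is monic of degree `g`, and `nodePoly_mul_redH`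
identifies it with the explicit `ℋ`. Let `M` be the sum of the points `(r, -a(r))` over the roots
`r` of `ℋ`.

Existence: `y + a` has finite zeros `M + ιD` (`ordAt_graph`) and `N` has `D + ιD`, so `(y + a)/N`
has divisor `M - D + ∞`.

Uniqueness (`eq_toDivisor_of_isReductionOf`): a function with divisor `D' - D + ∞`, multiplied by
`N`, is polynomial in `x, y` by `dvd_of_forall_ordAt_le`, vanishes on `ιD` and has a pole of order
at most `2g+1`. So it is `a' + βy` with `β` constant and `deg a' ≤ g`. A nonzero polynomial in `x`
of degree at most `g` cannot vanish on `ιD`; hence `β ≠ 0`, `a' = βa` and `D' = M`.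

System: `ℐ = a - cℋ` with `c` constant, and the common zeros of `ℋ` and `y + ℐ` form `M`
(`definedBySystem_graph`).

Orders at finite points are computed from a local parameter and the norm `a² - b²P` of `a + by`; the
pole order at infinity is the degree of that norm. -/

theorem root_mul_root (P : ℂ[X]) :
    AdjoinRoot.root (X ^ 2 - C P : ℂ[X][X]) * AdjoinRoot.root (X ^ 2 - C P) =
      AdjoinRoot.of (X ^ 2 - C P) P := by
  have h := AdjoinRoot.eval₂_root (X ^ 2 - C P : ℂ[X][X])
  simp only [eval₂_sub, eval₂_X_pow, eval₂_C] at h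
  rw [← sq]
  exact sub_eq_zero.mp h

theorem regFun_mul (a b c d : ℂ[X]) :
    regFun P a b * regFun P c d = regFun P (a * c + b * d * P) (a * d + b * c) := by
  have h := root_mul_root P
  simp only [regFun, map_add, map_mul]
  linear_combination (AdjoinRoot.of (X ^ 2 - C P) b * AdjoinRoot.of (X ^ 2 - C P) d) * h

theorem regFun_add (a b c d : ℂ[X]) :
    regFun P a b + regFun P c d = regFun P (a + c) (b + d) := by
  simp only [regFun, map_add]
  ring

theorem regFun_one : regFun P 1 0 = 1 := by simp [regFun]

theorem regFun_zero : regFun P 0 0 = 0 := by simp [regFun]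

theorem regFun_poly_mul (a c d : ℂ[X]) :
    regFun P a 0 * regFun P c d = regFun P (a * c) (a * d) := by
  simp [regFun_mul]

theorem regFun_poly_pow (a : ℂ[X]) (n : ℕ) : regFun P a 0 ^ n = regFun P (a ^ n) 0 := by
  simp [regFun]

theorem monic_defining (P : ℂ[X]) : (X ^ 2 - C P : ℂ[X][X]).Monic :=
  monic_X_pow_sub_C P two_ne_zero

theorem exists_eq_regFun (u : CoordRing P) : ∃ a b : ℂ[X], u = regFun P a b := by
  obtain ⟨p, rfl⟩ := AdjoinRoot.mk_surjective u
  have hd : (p %ₘ (X ^ 2 - C P)).natDegree ≤ 1 := by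
    have := natDegree_modByMonic_lt p (monic_defining P) (fun h => by
      have := congrArg natDegree h
      rw [natDegree_X_pow_sub_C] at this
      simp at this)
    rw [natDegree_X_pow_sub_C] at this
    omega
  have h1 : AdjoinRoot.mk (X ^ 2 - C P) p = AdjoinRoot.mk (X ^ 2 - C P) (p %ₘ (X ^ 2 - C P)) := by
    rw [AdjoinRoot.mk_eq_mk, modByMonic_eq_sub_mul_div, sub_sub_cancel]
    exact dvd_mul_right _ _
  rw [h1, eq_X_add_C_of_natDegree_le_one hd]
  refine ⟨(p %ₘ (X ^ 2 - C P)).coeff 0, (p %ₘ (X ^ 2 - C P)).coeff 1, ?_⟩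
  rw [map_add, map_mul, AdjoinRoot.mk_C, AdjoinRoot.mk_C, AdjoinRoot.mk_X, add_comm]
  rfl

theorem regFun_eq_zero_iff {a b : ℂ[X]} : regFun P a b = 0 ↔ a = 0 ∧ b = 0 := by
  constructor
  · intro h
    have h1 : regFun P a b = AdjoinRoot.mk (X ^ 2 - C P) (C b * X + C a) := by
      rw [map_add, map_mul, AdjoinRoot.mk_C, AdjoinRoot.mk_C, AdjoinRoot.mk_X, add_comm]
      rfl
    have h2 : (C b * X + C a : ℂ[X][X]) = 0 := by
      by_contra hne
      refine AdjoinRoot.mk_ne_zero_of_degree_lt (monic_defining P) hne ?_ (h1 ▸ h)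
      rw [degree_X_pow_sub_C two_pos]
      exact degree_linear_lt
    have h3 := congrArg (fun q => q.coeff 0) h2
    have h4 := congrArg (fun q => q.coeff 1) h2
    simp at h3 h4
    exact ⟨h3, by simpa using h4⟩
  · rintro ⟨rfl, rfl⟩
    exact regFun_zero

theorem regFun_inj {a b c d : ℂ[X]} : regFun P a b = regFun P c d ↔ a = c ∧ b = d := by
  have h : regFun P a b - regFun P c d = regFun P (a - c) (b - d) := by
    simp only [regFun, map_sub]; ring
  rw [← sub_eq_zero, h, regFun_eq_zero_iff, sub_eq_zero, sub_eq_zero]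

/-- The norm `a² - b² P` of the function `a + b y`. -/
def normPoly (P a b : ℂ[X]) : ℂ[X] := a ^ 2 - b ^ 2 * P

theorem regFun_mul_conj (a b : ℂ[X]) :
    regFun P a b * regFun P a (-b) = regFun P (normPoly P a b) 0 := by
  rw [regFun_mul, regFun_inj, normPoly]
  constructor <;> ring

theorem normPoly_mul (a b c d : ℂ[X]) :
    normPoly P (a * c + b * d * P) (a * d + b * c) = normPoly P a b * normPoly P c d := by
  simp only [normPoly]
  ring

/-- The degrees of `a²` and `b²P` have opposite parity, so the leading terms cannot cancel. -/
theorem natDegree_normPoly (hodd : Odd P.natDegree) (a b : ℂ[X]) :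
    (normPoly P a b).natDegree = poleOrder P a b := by
  unfold normPoly poleOrder
  split_ifs with hb
  · simp [hb, natDegree_pow]
  · have hP : P ≠ 0 := by rintro rfl; simp at hodd
    have h1 : (b ^ 2 * P).natDegree = 2 * b.natDegree + P.natDegree := by
      rw [natDegree_mul (pow_ne_zero 2 hb) hP, natDegree_pow]
    have h2 : (a ^ 2).natDegree = 2 * a.natDegree := natDegree_pow a 2
    obtain ⟨k, hk⟩ := hodd
    rcases lt_or_ge (2 * a.natDegree) (2 * b.natDegree + P.natDegree) with h | h
    · rw [natDegree_sub_eq_right_of_natDegree_lt (by omega), h1, max_eq_right h.le]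
    · rw [natDegree_sub_eq_left_of_natDegree_lt (by omega), h2, max_eq_left h]

theorem normPoly_ne_zero (hodd : Odd P.natDegree) {a b : ℂ[X]} (h : regFun P a b ≠ 0) :
    normPoly P a b ≠ 0 := by
  intro h0
  have hd := natDegree_normPoly hodd a b
  rw [h0, natDegree_zero] at hd
  have hpos : 0 < P.natDegree := hodd.pos
  unfold poleOrder at hd
  split_ifs at hd with hb
  · subst hb
    refine h (regFun_eq_zero_iff.2 ⟨?_, rfl⟩)
    simpa [normPoly] using h0
  · have := le_max_right (2 * a.natDegree) (2 * b.natDegree + P.natDegree)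
    omega

theorem noZeroDivisors_coordRing (hodd : Odd P.natDegree) : NoZeroDivisors (CoordRing P) := by
  refine ⟨fun {u v} huv => ?_⟩
  obtain ⟨a, b, rfl⟩ := exists_eq_regFun u
  obtain ⟨c, d, rfl⟩ := exists_eq_regFun v
  by_contra! hne
  refine mul_ne_zero (normPoly_ne_zero hodd hne.1) (normPoly_ne_zero hodd hne.2) ?_
  rw [← normPoly_mul]
  rw [regFun_mul, regFun_eq_zero_iff] at huv
  rw [huv.1, huv.2]
  simp [normPoly]

theorem poleOrder_mul (hodd : Odd P.natDegree) {a b c d : ℂ[X]} (h : regFun P a b ≠ 0)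
    (h' : regFun P c d ≠ 0) :
    poleOrder P (a * c + b * d * P) (a * d + b * c) = poleOrder P a b + poleOrder P c d := by
  simp only [← natDegree_normPoly hodd]
  rw [normPoly_mul, natDegree_mul (normPoly_ne_zero hodd h) (normPoly_ne_zero hodd h')]

theorem poleOrder_poly (p : ℂ[X]) : poleOrder P p 0 = 2 * p.natDegree := by simp [poleOrder]

/-! ### Evaluation at a finite point -/

/-- Evaluation of functions at a finite point. -/
def evalAt (Q : AffPoint P) : CoordRing P →+* ℂ :=
  AdjoinRoot.lift (evalRingHom Q.x) Q.y (by
    simp only [eval₂_sub, eval₂_X_pow, eval₂_C, coe_evalRingHom]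
    rw [Q.on_curve, sub_self])

@[simp] theorem evalAt_regFun (Q : AffPoint P) (a b : ℂ[X]) :
    evalAt Q (regFun P a b) = a.eval Q.x + b.eval Q.x * Q.y := by
  simp [evalAt, regFun]

theorem regFun_mem_maxIdeal (Q : AffPoint P) {a b : ℂ[X]}
    (h : a.eval Q.x + b.eval Q.x * Q.y = 0) : regFun P a b ∈ maxIdeal Q := by
  have hx : regFun P (X - C Q.x) 0 ∈ maxIdeal Q := Ideal.subset_span (by simp)
  have hy : regFun P (-C Q.y) 1 ∈ maxIdeal Q := Ideal.subset_span (by simp)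
  have hr : (a + b * C Q.y).IsRoot Q.x := by simpa [IsRoot] using h
  obtain ⟨q, hq⟩ := dvd_iff_isRoot.2 hr
  have : regFun P a b =
      regFun P q 0 * regFun P (X - C Q.x) 0 + regFun P b 0 * regFun P (-C Q.y) 1 := by
    rw [regFun_poly_mul, regFun_poly_mul, regFun_add, regFun_inj]
    constructor
    · linear_combination hq
    · ring
  rw [this]
  exact add_mem (Ideal.mul_mem_left _ _ hx) (Ideal.mul_mem_left _ _ hy)

theorem maxIdeal_eq_ker (Q : AffPoint P) : maxIdeal Q = RingHom.ker (evalAt Q) := by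
  apply le_antisymm
  · rw [maxIdeal, Ideal.span_le]
    rintro u (rfl | rfl) <;> simp [RingHom.mem_ker]
  · intro u hu
    obtain ⟨a, b, rfl⟩ := exists_eq_regFun u
    rw [RingHom.mem_ker, evalAt_regFun] at hu
    exact regFun_mem_maxIdeal Q hu

theorem mem_maxIdeal {Q : AffPoint P} {u : CoordRing P} : u ∈ maxIdeal Q ↔ evalAt Q u = 0 := by
  rw [maxIdeal_eq_ker, RingHom.mem_ker]

instance maxIdeal_isMaximal (Q : AffPoint P) : (maxIdeal Q).IsMaximal := by
  rw [maxIdeal_eq_ker]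
  exact RingHom.ker_isMaximal_of_surjective _ fun z => ⟨regFun P (C z) 0, by simp⟩

/-! ### The order of vanishing -/

open Classical in
/-- A local parameter at a finite point: `y` at a branch point, `x - x_Q` elsewhere. -/
def unif (Q : AffPoint P) : CoordRing P :=
  if Q.y = 0 then regFun P 0 1 else regFun P (X - C Q.x) 0

/-- `u` agrees with the `n`-th power of the local parameter at `Q` up to units at `Q`. -/
def HasOrd (Q : AffPoint P) (u : CoordRing P) (n : ℕ) : Prop :=
  ∃ e w : CoordRing P, evalAt Q e ≠ 0 ∧ evalAt Q w ≠ 0 ∧ e * u = unif Q ^ n * w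

theorem eval_deriv_ne_zero (hsq : Squarefree P) (Q : AffPoint P) (hy : Q.y = 0) :
    (derivative P).eval Q.x ≠ 0 := by
  have hr : P.eval Q.x = 0 := by rw [← Q.on_curve, hy]; ring
  have hsep : P.Separable := PerfectField.separable_iff_squarefree.2 hsq
  obtain ⟨a, b, hab⟩ := hsep
  intro h
  have := congrArg (eval Q.x) hab
  simp [hr, h] at this

theorem unif_ne_zero (Q : AffPoint P) : unif Q ≠ 0 := by
  unfold unif
  split_ifs
  · simp [regFun_eq_zero_iff]
  · simp only [ne_eq, regFun_eq_zero_iff, and_true]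
    exact X_sub_C_ne_zero _

theorem unif_mem (Q : AffPoint P) : unif Q ∈ maxIdeal Q := by
  rw [mem_maxIdeal]
  unfold unif
  split_ifs with h <;> simp [h]

theorem exists_eq_mul (Q : AffPoint P) :
    ∃ q : ℂ[X], P = C (Q.y ^ 2) + (X - C Q.x) * q ∧ q.eval Q.x = (derivative P).eval Q.x := by
  have hr : (P - C (Q.y ^ 2)).IsRoot Q.x := by simp [IsRoot, Q.on_curve]
  obtain ⟨q, hq⟩ := dvd_iff_isRoot.2 hr
  refine ⟨q, by linear_combination hq, ?_⟩
  have h : P = C (Q.y ^ 2) + (X - C Q.x) * q := by linear_combination hq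
  have := congrArg (fun p => (derivative p).eval Q.x) h
  rw [derivative_add, derivative_C, zero_add, derivative_mul] at this
  simpa using this.symm

/-- The maximal ideal is principal up to a factor invertible at `Q`. With `P = y_Q² + (x - x_Q) q`,
the relation is `(y + y_Q)(y - y_Q) = (x - x_Q) q`. The factor is `y + y_Q` if `y_Q ≠ 0`, and
otherwise `q`, whose value `P'(x_Q)` is nonzero as `P` is squarefree. -/
theorem exists_mul_le_span_unif (hsq : Squarefree P) (Q : AffPoint P) :
    ∃ e : CoordRing P, evalAt Q e ≠ 0 ∧ Ideal.span {e} * maxIdeal Q ≤ Ideal.span {unif Q} := by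
  obtain ⟨q, hq, hq'⟩ := exists_eq_mul Q
  by_cases hy : Q.y = 0
  · refine ⟨regFun P q 0, ?_, ?_⟩
    · simpa [hq'] using eval_deriv_ne_zero hsq Q hy
    · rw [maxIdeal, Ideal.span_mul_span', Ideal.span_le]
      rintro _ ⟨_, rfl, v, hv, rfl⟩
      simp only [SetLike.mem_coe, Ideal.mem_span_singleton, unif, if_pos hy]
      rcases hv with rfl | rfl
      · refine ⟨regFun P 0 1, ?_⟩
        simp only [regFun_mul, regFun_inj]
        refine ⟨?_, by ring⟩
        have : P = (X - C Q.x) * q := by simpa [hy] using hq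
        linear_combination -this
      · refine ⟨regFun P q 0, ?_⟩
        simp only [regFun_mul, regFun_inj, hy]
        constructor <;> simp
  · refine ⟨regFun P (C Q.y) 1, ?_, ?_⟩
    · simpa [← two_mul] using hy
    · rw [maxIdeal, Ideal.span_mul_span', Ideal.span_le]
      rintro _ ⟨_, rfl, v, hv, rfl⟩
      simp only [SetLike.mem_coe, Ideal.mem_span_singleton, unif, if_neg hy]
      rcases hv with rfl | rfl
      · exact Dvd.intro_left _ rfl
      · refine ⟨regFun P q 0, ?_⟩
        simp only [regFun_mul, regFun_inj]
        refine ⟨?_, by ring⟩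
        rw [C_pow] at hq
        linear_combination hq

theorem HasOrd.mul {Q : AffPoint P} {u v : CoordRing P} {m n : ℕ} (hu : HasOrd Q u m)
    (hv : HasOrd Q v n) : HasOrd Q (u * v) (m + n) := by
  obtain ⟨e, w, he, hw, h⟩ := hu
  obtain ⟨e', w', he', hw', h'⟩ := hv
  refine ⟨e * e', w * w', ?_, ?_, ?_⟩
  · rw [map_mul]; exact mul_ne_zero he he'
  · rw [map_mul]; exact mul_ne_zero hw hw'
  · rw [pow_add]
    linear_combination (e' * v) * h + (unif Q ^ m * w) * h'

theorem hasOrd_zero {Q : AffPoint P} {u : CoordRing P} (h : evalAt Q u ≠ 0) : HasOrd Q u 0 :=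
  ⟨1, u, by simp, h, by simp⟩

theorem hasOrd_unif (Q : AffPoint P) : HasOrd Q (unif Q) 1 := ⟨1, 1, by simp, by simp, by simp⟩

theorem HasOrd.pow {Q : AffPoint P} {u : CoordRing P} {m : ℕ} (hu : HasOrd Q u m) (n : ℕ) :
    HasOrd Q (u ^ n) (n * m) := by
  induction n with
  | zero => simpa using hasOrd_zero (Q := Q) (u := 1) (by simp)
  | succ n ih => rw [pow_succ, Nat.succ_mul]; exact ih.mul hu

theorem HasOrd.mem_pow_iff (hodd : Odd P.natDegree) (hsq : Squarefree P) {Q : AffPoint P}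
    {u : CoordRing P} {n : ℕ} (hu : HasOrd Q u n) (k : ℕ) : u ∈ maxIdeal Q ^ k ↔ k ≤ n := by
  have := noZeroDivisors_coordRing hodd
  obtain ⟨e, w, he, hw, h⟩ := hu
  constructor
  · intro hk
    by_contra! hlt
    obtain ⟨e₀, he₀, hle⟩ := exists_mul_le_span_unif hsq Q
    have h1 : e₀ ^ k * u ∈ Ideal.span {unif Q} ^ k := by
      refine Ideal.pow_right_mono hle k ?_
      rw [mul_pow]
      exact Ideal.mul_mem_mul (Ideal.pow_mem_pow (Ideal.mem_span_singleton_self _) k) hk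
    rw [Ideal.span_singleton_pow, Ideal.mem_span_singleton] at h1
    obtain ⟨z, hz⟩ := h1
    obtain ⟨j, rfl⟩ := Nat.exists_eq_add_of_lt hlt
    -- Cancelling `unif Q ^ n` and evaluating at `Q`, where the parameter vanishes, leaves a product
    -- of nonzero values equal to zero.
    have h2 : unif Q ^ n * (e₀ ^ (n + j + 1) * w - e * unif Q ^ (j + 1) * z) = 0 := by
      linear_combination (-e₀ ^ (n + j + 1)) * h + e * hz
    have h3 := (mul_eq_zero.1 h2).resolve_left (pow_ne_zero _ (unif_ne_zero Q))
    have h4 := congrArg (evalAt Q) h3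
    have h5 : evalAt Q (unif Q) = 0 := mem_maxIdeal.1 (unif_mem Q)
    simp [h5, he₀, hw] at h4
  · intro hk
    refine Ideal.pow_le_pow_right hk ?_
    have h1 : e * u ∈ maxIdeal Q ^ n := by
      rw [h]
      exact Ideal.mul_mem_right _ _ (Ideal.pow_mem_pow (unif_mem Q) n)
    exact (Ideal.IsMaximal.mul_mem_pow _ h1).resolve_left fun h' => he (mem_maxIdeal.1 h')

theorem HasOrd.ordAt_eq (hodd : Odd P.natDegree) (hsq : Squarefree P) {Q : AffPoint P}
    {u : CoordRing P} {n : ℕ} (hu : HasOrd Q u n) : ordAt Q u = n := by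
  have : {k : ℕ | u ∈ maxIdeal Q ^ k} = Set.Iic n := by
    ext k
    exact hu.mem_pow_iff hodd hsq k
  rw [ordAt, this, csSup_Iic]

theorem hasOrd_X_sub_C (hsq : Squarefree P) (Q : AffPoint P) :
    HasOrd Q (regFun P (X - C Q.x) 0) (if Q.y = 0 then 2 else 1) := by
  split_ifs with hy
  · obtain ⟨q, hq, hq'⟩ := exists_eq_mul Q
    refine ⟨regFun P q 0, 1, ?_, by simp, ?_⟩
    · simpa [hq'] using eval_deriv_ne_zero hsq Q hy
    · rw [unif, if_pos hy, mul_one, pow_two (regFun P 0 1), regFun_mul, regFun_mul, regFun_inj]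
      refine ⟨?_, by ring⟩
      have : P = (X - C Q.x) * q := by simpa [hy] using hq
      linear_combination -this
  · have := hasOrd_unif Q
    rwa [unif, if_neg hy] at this

theorem hasOrd_poly (hsq : Squarefree P) (Q : AffPoint P) {p : ℂ[X]} (hp : p ≠ 0) :
    HasOrd Q (regFun P p 0) (p.rootMultiplicity Q.x * if Q.y = 0 then 2 else 1) := by
  obtain ⟨q, hq, hnd⟩ := exists_eq_pow_rootMultiplicity_mul_and_not_dvd p hp Q.x
  have h := ((hasOrd_X_sub_C hsq Q).pow (p.rootMultiplicity Q.x)).mul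
    (hasOrd_zero (Q := Q) (u := regFun P q 0) (by
      simpa [dvd_iff_isRoot, IsRoot] using hnd))
  rw [regFun_poly_pow, regFun_poly_mul, ← hq, mul_zero, add_zero] at h
  exact h

/-- The order of a function that is not divisible by `x - x_Q`. -/
theorem hasOrd_of_primitive (hodd : Odd P.natDegree) (hsq : Squarefree P) (Q : AffPoint P)
    {a b : ℂ[X]} (hab : a.eval Q.x ≠ 0 ∨ b.eval Q.x ≠ 0) :
    HasOrd Q (regFun P a b)
      (if a.eval Q.x + b.eval Q.x * Q.y = 0 then (normPoly P a b).rootMultiplicity Q.x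
        else 0) := by
  have hne : regFun P a b ≠ 0 := by
    rw [ne_eq, regFun_eq_zero_iff]
    rintro ⟨rfl, rfl⟩
    simp at hab
  have hN := normPoly_ne_zero hodd hne
  split_ifs with h0
  · by_cases hy : Q.y = 0
    · have ha : a.eval Q.x = 0 := by simpa [hy] using h0
      have hb : b.eval Q.x ≠ 0 := hab.resolve_left (not_not.2 ha)
      obtain ⟨a', rfl⟩ := dvd_iff_isRoot.2 ha
      obtain ⟨q, hq, hq'⟩ := exists_eq_mul Q
      have hP : P = (X - C Q.x) * q := by simpa [hy] using hq
      have hd := eval_deriv_ne_zero hsq Q hy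
      have hm : (normPoly P ((X - C Q.x) * a') b).rootMultiplicity Q.x = 1 := by
        have hfac : normPoly P ((X - C Q.x) * a') b
            = (X - C Q.x) * ((X - C Q.x) * a' ^ 2 - b ^ 2 * q) := by
          rw [normPoly]; linear_combination (-b ^ 2) * hP
        rw [hfac] at hN ⊢
        rw [rootMultiplicity_mul hN, rootMultiplicity_X_sub_C_self,
          rootMultiplicity_eq_zero, add_zero]
        simp [IsRoot, hb, hq', hd]
      rw [hm]
      -- From `y² = (x - x_Q) q` one gets `q ((x - x_Q) a' + b y) = y (q b + a' y)`, and the last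
      -- factor is nonzero at `Q`: the order is one.
      refine ⟨regFun P q 0, regFun P (q * b) a', ?_, ?_, ?_⟩
      · simpa [hq'] using hd
      · simpa [hq', hy] using ⟨hd, hb⟩
      · rw [unif, if_pos hy, pow_one, regFun_mul, regFun_mul, regFun_inj]
        refine ⟨?_, by ring⟩
        linear_combination (-a') * hP
    -- Off the branch points `a + by` and `a - by` cannot both vanish at `Q`, so the conjugate is
    -- invertible there and the norm carries the whole order.
    · have h1 := hasOrd_poly hsq Q hN
      rw [if_neg hy, mul_one] at h1
      obtain ⟨e, w, he, hw, h⟩ := h1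
      refine ⟨e * regFun P a (-b), w, ?_, hw, ?_⟩
      · rw [map_mul]
        refine mul_ne_zero he ?_
        rw [evalAt_regFun, eval_neg]
        intro h2
        have ha : a.eval Q.x = 0 := by linear_combination (h0 + h2) / 2
        rw [ha, zero_add, mul_eq_zero] at h0
        exact hab.elim (fun h => h ha) (fun h => h (h0.resolve_right hy))
      · rw [← h, ← regFun_mul_conj]
        ring
  · exact hasOrd_zero (by simpa using h0)

/-- Common factors `x - x_Q` of `a` and `b` are stripped off one at a time; each lowers the degree
of the norm by two. -/
theorem exists_hasOrd (hodd : Odd P.natDegree) (hsq : Squarefree P) (Q : AffPoint P)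
    {u : CoordRing P} (hu : u ≠ 0) : ∃ n, HasOrd Q u n := by
  obtain ⟨a, b, rfl⟩ := exists_eq_regFun u
  induction hk : (normPoly P a b).natDegree using Nat.strong_induction_on generalizing a b with
  | _ k ih =>
    by_cases hab : a.eval Q.x ≠ 0 ∨ b.eval Q.x ≠ 0
    · exact ⟨_, hasOrd_of_primitive hodd hsq Q hab⟩
    · push Not at hab
      obtain ⟨a', rfl⟩ := dvd_iff_isRoot.2 hab.1
      obtain ⟨b', rfl⟩ := dvd_iff_isRoot.2 hab.2
      have hmul : regFun P ((X - C Q.x) * a') ((X - C Q.x) * b')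
          = regFun P (X - C Q.x) 0 * regFun P a' b' := (regFun_poly_mul _ _ _).symm
      have hne : regFun P a' b' ≠ 0 := by
        intro h
        rw [hmul, h, mul_zero] at hu
        exact hu rfl
      have hnorm : normPoly P ((X - C Q.x) * a') ((X - C Q.x) * b')
          = (X - C Q.x) ^ 2 * normPoly P a' b' := by
        simp only [normPoly]; ring
      have hdeg : (normPoly P a' b').natDegree < k := by
        rw [← hk, hnorm, natDegree_mul (pow_ne_zero 2 (X_sub_C_ne_zero _))
          (normPoly_ne_zero hodd hne), natDegree_pow, natDegree_X_sub_C]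
        omega
      obtain ⟨n, hn⟩ := ih _ hdeg a' b' hne rfl
      rw [hmul]
      exact ⟨_, (hasOrd_X_sub_C hsq Q).mul hn⟩

section Order

variable (hodd : Odd P.natDegree) (hsq : Squarefree P) (Q : AffPoint P)
include hodd hsq

theorem ordAt_mul {u v : CoordRing P} (hu : u ≠ 0) (hv : v ≠ 0) :
    ordAt Q (u * v) = ordAt Q u + ordAt Q v := by
  obtain ⟨m, hm⟩ := exists_hasOrd hodd hsq Q hu
  obtain ⟨n, hn⟩ := exists_hasOrd hodd hsq Q hv
  rw [(hm.mul hn).ordAt_eq hodd hsq, hm.ordAt_eq hodd hsq, hn.ordAt_eq hodd hsq]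

theorem le_ordAt_iff {u : CoordRing P} (hu : u ≠ 0) (k : ℕ) :
    k ≤ ordAt Q u ↔ u ∈ maxIdeal Q ^ k := by
  obtain ⟨m, hm⟩ := exists_hasOrd hodd hsq Q hu
  rw [hm.ordAt_eq hodd hsq, hm.mem_pow_iff hodd hsq]

theorem ordAt_poly {p : ℂ[X]} (hp : p ≠ 0) :
    ordAt Q (regFun P p 0) = p.rootMultiplicity Q.x * if Q.y = 0 then 2 else 1 :=
  (hasOrd_poly hsq Q hp).ordAt_eq hodd hsq

theorem ordAt_add_y (a : ℂ[X]) :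
    ordAt Q (regFun P a 1) =
      if a.eval Q.x + Q.y = 0 then (a ^ 2 - P).rootMultiplicity Q.x else 0 := by
  have h := (hasOrd_of_primitive hodd hsq Q (a := a) (b := 1) (Or.inr (by simp))).ordAt_eq
    hodd hsq
  simpa [normPoly] using h

end Order

/-! ### Divisibility by a polynomial in `x`, detected by orders of vanishing. -/

theorem exists_affPoint (P : ℂ[X]) (r : ℂ) : ∃ Q : AffPoint P, Q.x = r := by
  obtain ⟨s, hs⟩ := IsAlgClosed.exists_pow_nat_eq (P.eval r) two_pos
  exact ⟨⟨r, s, hs⟩, rfl⟩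

/-- A function whose zeros dominate those of `p(x)` is divisible by `p(x)`. -/
theorem dvd_of_ordAt_le (hodd : Odd P.natDegree) (hsq : Squarefree P) {p : ℂ[X]} (hp : p ≠ 0)
    {u : CoordRing P} (hu : u ≠ 0) (h : ∀ Q, ordAt Q (regFun P p 0) ≤ ordAt Q u) :
    regFun P p 0 ∣ u := by
  induction hk : p.natDegree generalizing p u with
  | zero =>
    rw [natDegree_eq_zero] at hk
    obtain ⟨c, rfl⟩ := hk
    have hc : c ≠ 0 := by rintro rfl; simp at hp
    refine ⟨regFun P (C c⁻¹) 0 * u, ?_⟩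
    rw [← mul_assoc, regFun_poly_mul, ← C_mul, mul_inv_cancel₀ hc, mul_zero, C_1, regFun_one,
      one_mul]
  | succ n ih =>
    obtain ⟨r, hr⟩ := IsAlgClosed.exists_root p (by
      rw [degree_eq_natDegree hp, hk]; exact_mod_cast n.succ_ne_zero)
    have hrm : 1 ≤ p.rootMultiplicity r := (rootMultiplicity_pos hp).2 hr
    obtain ⟨a, b, rfl⟩ := exists_eq_regFun u
    obtain ⟨Q, rfl⟩ := exists_affPoint P r
    -- Off the branch points, vanishing at both `Q` and `ιQ` kills `a` and `b`. At a branch point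
    -- the order is at least two, whereas `b(x_Q) ≠ 0` would give the norm a simple root, its
    -- derivative there being `-b²P'`.
    have hab : a.eval Q.x = 0 ∧ b.eval Q.x = 0 := by
      have h1 : 1 ≤ ordAt Q (regFun P a b) := by
        refine le_trans ?_ (h Q)
        rw [ordAt_poly hodd hsq Q hp]
        exact Nat.mul_pos hrm (by split_ifs <;> norm_num)
      have h2 : a.eval Q.x + b.eval Q.x * Q.y = 0 := by
        rw [le_ordAt_iff hodd hsq Q hu, pow_one, mem_maxIdeal] at h1
        simpa using h1
      by_cases hy : Q.y = 0
      · by_contra hne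
        have hne' : a.eval Q.x ≠ 0 ∨ b.eval Q.x ≠ 0 := by tauto
        have ha : a.eval Q.x = 0 := by simpa [hy] using h2
        have hb := hne'.resolve_left (not_not.2 ha)
        have h3 : 2 ≤ ordAt Q (regFun P a b) := by
          refine le_trans ?_ (h Q)
          rw [ordAt_poly hodd hsq Q hp, if_pos hy]
          omega
        have h4 := (hasOrd_of_primitive hodd hsq Q hne').ordAt_eq hodd hsq
        rw [if_pos h2] at h4
        rw [h4] at h3
        have h5 : (normPoly P a b).rootMultiplicity Q.x < 2 := by
          by_contra! h6
          rw [le_rootMultiplicity_iff (normPoly_ne_zero hodd hu)] at h6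
          obtain ⟨c, hc⟩ := h6
          have h7 := congrArg (fun p => (derivative p).eval Q.x) hc
          have hP : P.eval Q.x = 0 := by rw [← Q.on_curve, hy]; ring
          simp [normPoly, derivative_mul, derivative_pow, ha, hP] at h7
          exact h7.elim hb (eval_deriv_ne_zero hsq Q hy)
        omega
      · have h1' : 1 ≤ ordAt Q.invol (regFun P a b) := by
          refine le_trans ?_ (h Q.invol)
          rw [ordAt_poly hodd hsq _ hp]
          exact Nat.mul_pos hrm (by split_ifs <;> norm_num)
        rw [le_ordAt_iff hodd hsq _ hu, pow_one, mem_maxIdeal] at h1'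
        simp only [evalAt_regFun, AffPoint.invol] at h1'
        have ha : a.eval Q.x = 0 := by linear_combination (h1' + h2) / 2
        refine ⟨ha, ?_⟩
        rw [ha, zero_add, mul_eq_zero] at h2
        exact h2.resolve_right hy
    obtain ⟨a', rfl⟩ := dvd_iff_isRoot.2 hab.1
    obtain ⟨b', rfl⟩ := dvd_iff_isRoot.2 hab.2
    obtain ⟨q, rfl⟩ := dvd_iff_isRoot.2 hr
    have hq : q ≠ 0 := right_ne_zero_of_mul hp
    have hmul : regFun P ((X - C Q.x) * a') ((X - C Q.x) * b')
        = regFun P (X - C Q.x) 0 * regFun P a' b' := (regFun_poly_mul _ _ _).symm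
    have hmul' : regFun P ((X - C Q.x) * q) 0 = regFun P (X - C Q.x) 0 * regFun P q 0 := by
      rw [regFun_poly_mul, mul_zero]
    have hne : regFun P a' b' ≠ 0 := by
      intro h
      rw [hmul, h, mul_zero] at hu
      exact hu rfl
    have hq' : regFun P q 0 ≠ 0 := by simpa [regFun_eq_zero_iff] using hq
    have hX : regFun P (X - C Q.x) 0 ≠ 0 := by
      simpa [regFun_eq_zero_iff] using X_sub_C_ne_zero Q.x
    rw [hmul, hmul']
    refine mul_dvd_mul_left _ (ih hq hne (fun R => ?_) ?_)
    · have := h R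
      rw [hmul, hmul', ordAt_mul hodd hsq R hX hq', ordAt_mul hodd hsq R hX hne] at this
      omega
    · rw [natDegree_mul (X_sub_C_ne_zero _) hq, natDegree_X_sub_C] at hk
      omega

/-! ### The generating function of the complete symmetric polynomials -/

/-- Expanding the product of geometric series, the monomials of degree `j` correspond to multisets
of size `j` through their exponent vectors. -/
theorem hsymm_aeval_eq_coeff {n : ℕ} (z : Fin n → ℂ) (j : ℕ) :
    MvPolynomial.aeval z (MvPolynomial.hsymm (Fin n) ℂ j) =
      PowerSeries.coeff j (∏ i, PowerSeries.mk fun m => z i ^ m) := by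
  rw [PowerSeries.coeff_prod, MvPolynomial.hsymm, map_sum]
  refine Finset.sum_bij' (fun s _ => Multiset.toFinsupp s.1)
    (fun l hl => ⟨Finsupp.toMultiset l, by
      rw [Finset.mem_finsuppAntidiag'] at hl
      rw [Finsupp.card_toMultiset]
      exact hl.1⟩) ?_ ?_ ?_ ?_ ?_
  · intro s _
    rw [Finset.mem_finsuppAntidiag']
    refine ⟨?_, Finset.subset_univ _⟩
    have := Multiset.toFinsupp_sum_eq s.1
    rw [s.2] at this
    exact this
  · intro l _
    exact Finset.mem_univ _
  · intro s _
    exact Subtype.ext (by simp)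
  · intro l _
    simp
  · intro s _
    rw [map_multiset_prod, Multiset.map_map, Finset.prod_multiset_map_count]
    simp only [Function.comp_apply, MvPolynomial.aeval_X, PowerSeries.coeff_mk,
      Multiset.toFinsupp_apply]
    refine Finset.prod_subset (Finset.subset_univ _) fun i _ hi => ?_
    rw [Multiset.mem_toFinset, ← Multiset.count_eq_zero] at hi
    rw [hi, pow_zero]

theorem one_sub_mul_geom (z : ℂ) :
    (((1 - C z * X : ℂ[X]) : PowerSeries ℂ)) * PowerSeries.mk (fun m => z ^ m) = 1 := by
  have h : ((1 - C z * X : ℂ[X]) : PowerSeries ℂ) = 1 - PowerSeries.C z * PowerSeries.X := by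
    simp
  rw [h]
  ext n
  rw [sub_mul, one_mul, mul_assoc, map_sub, PowerSeries.coeff_C_mul]
  cases n with
  | zero => simp
  | succ n => simp [PowerSeries.coeff_succ_X_mul, PowerSeries.coeff_one, pow_succ']

theorem reverse_X_sub_C (z : ℂ) : reverse (X - C z : ℂ[X]) = 1 - C z * X := by
  have h : (X - C z : ℂ[X]) = C 1 * X ^ 1 - C z := by simp
  rw [reverse, natDegree_X_sub_C]
  simp [reflect_sub, reflect_C]

theorem reverse_prod_X_sub_C {ι : Type*} (s : Finset ι) (z : ι → ℂ) :
    reverse (∏ i ∈ s, (X - C (z i)) : ℂ[X]) = ∏ i ∈ s, (1 - C (z i) * X) := by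
  classical
  induction s using Finset.induction_on with
  | empty =>
    rw [Finset.prod_empty, Finset.prod_empty]
    exact reverse_C (1 : ℂ)
  | insert i s hi ih =>
    rw [Finset.prod_insert hi, Finset.prod_insert hi, reverse_mul_of_domain, ih, reverse_X_sub_C]

/-- The reversed product `∏ (1 - z_i t)` is inverse to `∑ h_j t^j`; the inner sums are the
coefficients of `(∑ h_j t^j)(∑ λ_{2k} t^k)`. -/
theorem coeff_reverse_mul_generating {n : ℕ} (z : Fin n → ℂ) (lam : ℕ → ℂ) (m : ℕ) :
    ∑ p ∈ Finset.HasAntidiagonal.antidiagonal m, (reverse (∏ i, (X - C (z i)) : ℂ[X])).coeff p.1 *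
      (∑ j ∈ Finset.range (p.2 + 1), lam (2 * p.2 - 2 * j) *
        MvPolynomial.aeval z (MvPolynomial.hsymm (Fin n) ℂ j)) = lam (2 * m) := by
  set G : PowerSeries ℂ := ∏ i, PowerSeries.mk fun m => z i ^ m with hG
  have h1 : ((reverse (∏ i, (X - C (z i)) : ℂ[X]) : ℂ[X]) : PowerSeries ℂ) * G = 1 := by
    rw [reverse_prod_X_sub_C, ← coeToPowerSeries.ringHom_apply, map_prod, hG,
      ← Finset.prod_mul_distrib]
    refine Finset.prod_eq_one fun i _ => ?_
    rw [coeToPowerSeries.ringHom_apply]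
    exact one_sub_mul_geom (z i)
  have h2 := congrArg (PowerSeries.coeff m)
    (show ((reverse (∏ i, (X - C (z i)) : ℂ[X]) : ℂ[X]) : PowerSeries ℂ) *
      (G * PowerSeries.mk fun k => lam (2 * k)) = PowerSeries.mk fun k => lam (2 * k) by
        rw [← mul_assoc, h1, one_mul])
  rw [PowerSeries.coeff_mul, PowerSeries.coeff_mk] at h2
  rw [← h2]
  refine Finset.sum_congr rfl fun p _ => ?_
  rw [coeff_coe, PowerSeries.coeff_mul, Finset.Nat.sum_antidiagonal_eq_sum_range_succ_mk]
  congr 1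
  refine Finset.sum_congr rfl fun j _ => ?_
  rw [hsymm_aeval_eq_coeff, PowerSeries.coeff_mk, Nat.mul_sub, mul_comm]

/-! ### The curve polynomial -/

theorem degree_const_mul_le (c : ℂ) (q : ℂ[X]) : (C c * q).degree ≤ q.degree := by
  rw [← smul_eq_C_mul]
  exact degree_smul_le c q


theorem curvePoly_eq_sum (g : ℕ) (lam : ℕ → ℂ) :
    curvePoly g lam = ∑ n ∈ Finset.range (2 * g + 2), C (lam (4 * g + 2 - 2 * n)) * X ^ n := by
  rw [Finset.sum_range_succ, curvePoly, add_comm]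
  congr 4
  omega

theorem coeff_curvePoly {g : ℕ} (lam : ℕ → ℂ) {n : ℕ} (hn : n < 2 * g + 2) :
    (curvePoly g lam).coeff n = lam (4 * g + 2 - 2 * n) := by
  simp [curvePoly_eq_sum, finsetSum_coeff, coeff_X_pow, hn]

theorem degree_curvePoly_lt (g : ℕ) (lam : ℕ → ℂ) :
    (curvePoly g lam).degree < (2 * g + 2 : ℕ) := by
  rw [degree_lt_iff_coeff_zero]
  intro m hm
  simp [curvePoly_eq_sum, finsetSum_coeff, coeff_X_pow]
  intro h
  omega

theorem natDegree_curvePoly {g : ℕ} {lam : ℕ → ℂ} (hlam : lam 0 = 1) :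
    (curvePoly g lam).natDegree = 2 * g + 1 := by
  refine natDegree_eq_of_le_of_coeff_ne_zero ?_ ?_
  · refine natDegree_le_iff_coeff_eq_zero.2 fun N hN => coeff_eq_zero_of_degree_lt ?_
    exact (degree_curvePoly_lt g lam).trans_le (by exact_mod_cast hN)
  · rw [coeff_curvePoly lam (by omega), show 4 * g + 2 - 2 * (2 * g + 1) = 0 by omega, hlam]
    exact one_ne_zero

theorem monic_curvePoly {g : ℕ} {lam : ℕ → ℂ} (hlam : lam 0 = 1) : (curvePoly g lam).Monic := by
  rw [Monic, leadingCoeff, natDegree_curvePoly hlam, coeff_curvePoly lam (by omega),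
    show 4 * g + 2 - 2 * (2 * g + 1) = 0 by omega, hlam]

theorem odd_natDegree_curvePoly {g : ℕ} {lam : ℕ → ℂ} (hlam : lam 0 = 1) :
    Odd (curvePoly g lam).natDegree := by
  rw [natDegree_curvePoly hlam]
  exact ⟨g, rfl⟩

section Nodes

variable (g : ℕ) [NeZero g] (lam : ℕ → ℂ) (x y : Fin g → ℂ)

/-- The polynomial `(x - x₁)² ∏_{i=2}^g (x - x_i)`. -/
def nodePoly : ℂ[X] := (X - C (x 0)) ^ 2 * tailPoly g x

theorem nodePoly_eq_prod :
    nodePoly g x = ∏ i : Fin (g + 1), (X - C ((Fin.snoc x (x 0) : Fin (g + 1) → ℂ) i)) := by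
  rw [Fin.prod_univ_castSucc]
  simp only [Fin.snoc_castSucc, Fin.snoc_last]
  rw [← Finset.mul_prod_erase Finset.univ (fun i => X - C (x i)) (Finset.mem_univ 0), nodePoly,
    tailPoly, tail]
  ring

theorem card_tail : (tail g).card = g - 1 := by
  rw [tail, Finset.card_erase_of_mem (Finset.mem_univ _), Finset.card_univ, Fintype.card_fin]

theorem monic_tailPoly : (tailPoly g x).Monic := 
  monic_prod_of_monic _ _ fun _ _ => monic_X_sub_C _

theorem natDegree_tailPoly : (tailPoly g x).natDegree = g - 1 := by
  rw [tailPoly, natDegree_prod_of_monic _ _ fun i _ => monic_X_sub_C _]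
  simp [card_tail]

theorem monic_nodePoly : (nodePoly g x).Monic :=
  ((monic_X_sub_C _).pow 2).mul (monic_tailPoly g x)

theorem natDegree_nodePoly : (nodePoly g x).natDegree = g + 1 := by
  have := NeZero.pos g
  rw [nodePoly, ((monic_X_sub_C _).pow 2).natDegree_mul (monic_tailPoly g x),
    (monic_X_sub_C _).natDegree_pow, natDegree_X_sub_C, natDegree_tailPoly]
  omega

/-- The polynomial part of the quotient of the curve polynomial by `nodePoly`. -/
def curveQuot : ℂ[X] :=
  ∑ n ∈ Finset.range (g + 1),
    X ^ n * C (∑ j ∈ Finset.range (g - n + 1), lam (2 * g - 2 * n - 2 * j) * hDoubled g x j)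

theorem coeff_curveQuot {n : ℕ} (hn : n < g + 1) :
    (curveQuot g lam x).coeff n =
      ∑ j ∈ Finset.range (g - n + 1), lam (2 * g - 2 * n - 2 * j) * hDoubled g x j := by
  rw [curveQuot, finsetSum_coeff]
  simp only [coeff_mul_C, coeff_X_pow]
  simp [hn]

theorem natDegree_curveQuot_le : (curveQuot g lam x).natDegree ≤ g := by
  refine natDegree_sum_le_of_forall_le _ _ fun n hn => ?_
  refine (natDegree_mul_C_le _ _).trans ?_
  rw [natDegree_X_pow]
  exact Nat.lt_succ_iff.1 (Finset.mem_range.1 hn)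

/-- `curveQuot` is the quotient of the division of the curve polynomial by `nodePoly`. Read from the
top, the coefficients of degrees `2g+1, …, g+1` are those of indices `m = 0, …, g` in the power
series identity `coeff_reverse_mul_generating`, and these involve only the coefficients kept in
`curveQuot`. -/
theorem degree_curvePoly_sub_lt :
    (curvePoly g lam - nodePoly g x * curveQuot g lam x).degree < (g + 1 : ℕ) := by
  rw [degree_lt_iff_coeff_zero]
  intro N hN
  rw [coeff_sub]
  rcases lt_or_ge N (2 * g + 2) with h | h
  · obtain ⟨m, hm⟩ : ∃ m, N + m = 2 * g + 1 := ⟨2 * g + 1 - N, by omega⟩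
    have hmg : m ≤ g := by omega
    have h1 : (nodePoly g x * curveQuot g lam x).coeff N =
        (reflect (g + 1 + g) (nodePoly g x * curveQuot g lam x)).coeff m := by
      rw [coeff_reflect, revAt_le (by omega)]
      congr 1
      omega
    rw [h1, reflect_mul _ _ (natDegree_nodePoly g x).le (natDegree_curveQuot_le g lam x),
      coeff_mul, coeff_curvePoly lam h, show 4 * g + 2 - 2 * N = 2 * m by omega,
      ← coeff_reverse_mul_generating (Fin.snoc x (x 0) : Fin (g + 1) → ℂ) lam m, sub_eq_zero]
    refine Finset.sum_congr rfl fun p hp => ?_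
    have hp' := Finset.HasAntidiagonal.mem_antidiagonal.1 hp
    rw [← nodePoly_eq_prod, reverse, natDegree_nodePoly]
    congr 1
    rw [coeff_reflect, revAt_le (by omega), coeff_curveQuot g lam x (by omega),
      show g - (g - p.2) = p.2 by omega, show 2 * g - 2 * (g - p.2) = 2 * p.2 by omega]
    rfl
  · rw [coeff_eq_zero_of_degree_lt ((degree_curvePoly_lt g lam).trans_le (by exact_mod_cast h)),
      coeff_eq_zero_of_natDegree_lt, sub_zero]
    refine lt_of_le_of_lt natDegree_mul_le ?_
    have := natDegree_curveQuot_le g lam x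
    rw [natDegree_nodePoly]
    omega

/-! ### Hermite interpolation with one double node -/

/-- The interpolation polynomial with value `v k` at `x k` and with derivative `d` at `x 0`. -/
def hermite (v : Fin g → ℂ) (d : ℂ) : ℂ[X] :=
  C (tailProd g x)⁻¹ * tailPoly g x * (C (v 0) + C (d - v 0 * invSum g x) * (X - C (x 0))) +
    ∑ k ∈ tail g, C (v k / ((x k - x 0) * nodeProd g x k)) *
      ((X - C (x 0)) * ∏ i ∈ Finset.univ.erase k, (X - C (x i)))

variable {g x}

theorem mem_tail {k : Fin g} : k ∈ tail g ↔ k ≠ 0 := by simp [tail]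

theorem prod_erase_eq {k : Fin g} (hk : k ∈ tail g) :
    ∏ i ∈ Finset.univ.erase k, (X - C (x i)) =
      (X - C (x 0)) * ∏ i ∈ (tail g).erase k, (X - C (x i)) := by
  rw [tail, Finset.erase_right_comm]
  refine (Finset.mul_prod_erase _ _ ?_).symm
  rw [Finset.mem_erase]
  exact ⟨(mem_tail.1 hk).symm, Finset.mem_univ _⟩

theorem tailPoly_eq {k : Fin g} (hk : k ∈ tail g) :
    tailPoly g x = (X - C (x k)) * ∏ i ∈ (tail g).erase k, (X - C (x i)) :=
  (Finset.mul_prod_erase _ _ hk).symm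

theorem eval_tailPoly_zero : (tailPoly g x).eval (x 0) = tailProd g x := by
  simp [tailPoly, tailProd, eval_prod]

theorem eval_tailPoly_node {k : Fin g} (hk : k ∈ tail g) : (tailPoly g x).eval (x k) = 0 := by
  simp [tailPoly_eq hk]

variable (hx : Function.Injective x)
include hx

theorem tailProd_ne_zero : tailProd g x ≠ 0 :=
  Finset.prod_ne_zero_iff.2 fun _ hi => sub_ne_zero.2 (hx.ne (mem_tail.1 hi).symm)

omit [NeZero g] in
theorem nodeProd_ne_zero (k : Fin g) : nodeProd g x k ≠ 0 :=
  Finset.prod_ne_zero_iff.2 fun _ hi => sub_ne_zero.2 (hx.ne (Finset.ne_of_mem_erase hi).symm)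

theorem node_sub_ne_zero {k : Fin g} (hk : k ∈ tail g) : x k - x 0 ≠ 0 :=
  sub_ne_zero.2 (hx.ne (mem_tail.1 hk))

theorem eval_derivative_tailPoly :
    (derivative (tailPoly g x)).eval (x 0) = tailProd g x * invSum g x := by
  rw [tailPoly, derivative_prod_finset, eval_finsetSum, tailProd, invSum, Finset.mul_sum]
  refine Finset.sum_congr rfl fun i hi => ?_
  have hne : x 0 - x i ≠ 0 := sub_ne_zero.2 (hx.ne (mem_tail.1 hi).symm)
  rw [← Finset.mul_prod_erase _ _ hi]
  simp [eval_prod]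
  field_simp

omit hx in
theorem eval_hermite_zero (hx : Function.Injective x) (v : Fin g → ℂ) (d : ℂ) :
    (hermite g x v d).eval (x 0) = v 0 := by
  simp [hermite, eval_finsetSum, eval_tailPoly_zero]
  field_simp [tailProd_ne_zero hx]

theorem eval_hermite (v : Fin g → ℂ) (d : ℂ) (k : Fin g) :
    (hermite g x v d).eval (x k) = v k := by
  by_cases hk : k ∈ tail g
  · rw [hermite, eval_add, eval_mul, eval_mul, eval_tailPoly_node hk, eval_finsetSum,
      Finset.sum_eq_single_of_mem k hk]
    · have h1 := node_sub_ne_zero hx hk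
      have h2 := nodeProd_ne_zero hx k
      have h3 : eval (x k) (∏ i ∈ Finset.univ.erase k, (X - C (x i))) = nodeProd g x k := by
        simp [eval_prod, nodeProd]
      rw [eval_mul, eval_mul, h3]
      simp
      field_simp
    · intro j hj hjk
      have : k ∈ Finset.univ.erase j := Finset.mem_erase.2 ⟨hjk.symm, Finset.mem_univ _⟩
      rw [← Finset.mul_prod_erase _ _ this]
      simp
  · rw [mem_tail, not_not] at hk
    rw [hk]
    exact eval_hermite_zero hx v d

theorem eval_derivative_hermite (v : Fin g → ℂ) (d : ℂ) :
    (derivative (hermite g x v d)).eval (x 0) = d := by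
  have h1 := tailProd_ne_zero hx
  have h2 : ∀ k ∈ tail g, (derivative (C (v k / ((x k - x 0) * nodeProd g x k)) *
      ((X - C (x 0)) * ∏ i ∈ Finset.univ.erase k, (X - C (x i))))).eval (x 0) = 0 := by
    intro k hk
    rw [prod_erase_eq hk]
    simp [derivative_mul]
  rw [hermite, derivative_add, derivative_sum, eval_add, eval_finsetSum, Finset.sum_eq_zero h2]
  simp [derivative_mul, eval_tailPoly_zero, eval_derivative_tailPoly hx]
  field_simp
  ring

omit hx in
theorem natDegree_hermite_le (v : Fin g → ℂ) (d : ℂ) : (hermite g x v d).natDegree ≤ g := by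
  have hg := NeZero.pos g
  refine natDegree_add_le_of_degree_le ?_ (natDegree_sum_le_of_forall_le _ _ fun k hk => ?_)
  · refine natDegree_mul_le.trans ?_
    have h1 := natDegree_C_mul_le (tailProd g x)⁻¹ (tailPoly g x)
    have h2 : (C (v 0) + C (d - v 0 * invSum g x) * (X - C (x 0))).natDegree ≤ 1 := by
      compute_degree
    rw [natDegree_tailPoly] at h1
    omega
  · refine (natDegree_C_mul_le _ _).trans (natDegree_mul_le.trans ?_)
    rw [natDegree_X_sub_C, natDegree_prod_of_monic _ _ fun i _ => monic_X_sub_C _]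
    simp
    omega

theorem nodePoly_dvd {f : ℂ[X]} (hf : ∀ k, f.eval (x k) = 0)
    (hf' : (derivative f).eval (x 0) = 0) : nodePoly g x ∣ f := by
  have h1 : (X - C (x 0)) ^ 2 ∣ f := by
    obtain ⟨q, rfl⟩ := dvd_iff_isRoot.2 (hf 0)
    rw [sq]
    refine mul_dvd_mul_left _ (dvd_iff_isRoot.2 ?_)
    simpa [derivative_mul] using hf'
  have h2 : tailPoly g x ∣ f := by
    refine Finset.prod_dvd_of_coprime ?_ fun k _ => dvd_iff_isRoot.2 (hf k)
    exact fun i _ j _ hij => pairwise_coprime_X_sub_C hx hij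
  refine IsCoprime.mul_dvd (IsCoprime.pow_left (IsCoprime.prod_right fun k hk => ?_)) h1 h2
  exact pairwise_coprime_X_sub_C hx (mem_tail.1 hk).symm

/-- The difference of the two sides is divisible by `nodePoly`, of degree `g + 1`. -/
theorem eq_hermite {f : ℂ[X]} (hf : f.degree < (g + 1 : ℕ)) :
    f = hermite g x (fun k => f.eval (x k)) ((derivative f).eval (x 0)) := by
  rw [← sub_eq_zero]
  refine eq_zero_of_dvd_of_degree_lt (nodePoly_dvd hx (fun k => ?_) ?_)
    (?_ : _ < degree (nodePoly g x))
  · rw [eval_sub, eval_hermite hx, sub_self]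
  · rw [derivative_sub, eval_sub, eval_derivative_hermite hx, sub_self]
  · rw [degree_eq_natDegree (monic_nodePoly g x).ne_zero, natDegree_nodePoly]
    refine (degree_sub_le _ _).trans_lt (max_lt hf ?_)
    exact (degree_le_natDegree).trans_lt (by
      exact_mod_cast Nat.lt_succ_of_le (natDegree_hermite_le _ _))

/-! ### The polynomials `ℋ` and `ℐ` -/

/-- The numerator of the summand of `hermite` belonging to the simple node `x k`. -/
def simpleTerm (x : Fin g → ℂ) (k : Fin g) : ℂ[X] :=
  C ((x k - x 0) * nodeProd g x k)⁻¹ *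
    ((X - C (x 0)) ^ 2 * ∏ i ∈ (tail g).erase k, (X - C (x i)))

omit hx in
theorem hermite_eq (v : Fin g → ℂ) (d : ℂ) :
    hermite g x v d = C (tailProd g x)⁻¹ * tailPoly g x *
      (C (v 0) + C (d - v 0 * invSum g x) * (X - C (x 0))) +
        ∑ k ∈ tail g, C (v k) * simpleTerm x k := by
  rw [hermite]
  congr 1
  refine Finset.sum_congr rfl fun k hk => ?_
  rw [prod_erase_eq hk, simpleTerm, div_eq_mul_inv, C_mul]
  ring

/-- Interpolation of the constant `1`; it makes products of interpolants comparable with single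
interpolants in `nodePoly_mul_redH`. -/
theorem partition_of_one :
    C (tailProd g x)⁻¹ * tailPoly g x * (1 - C (invSum g x) * (X - C (x 0))) +
      ∑ k ∈ tail g, simpleTerm x k = 1 := by
  have h := eq_hermite hx (f := 1) (by
    rw [degree_one]
    exact_mod_cast Nat.succ_pos g)
  rw [hermite_eq] at h
  simp only [eval_one, derivative_one, eval_zero, map_one, one_mul, zero_sub] at h
  rw [C_neg] at h
  linear_combination -h

omit hx in
theorem mul_divByMonic_tailPoly :
    (X - C (x 0)) * ((tailPoly g x - C (tailProd g x)) /ₘ (X - C (x 0))) =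
      tailPoly g x - C (tailProd g x) := by
  rw [mul_divByMonic_eq_iff_isRoot, IsRoot, eval_sub, eval_tailPoly_zero, eval_C, sub_self]

variable {lam y}

/-- The first summand of `redH` is the quotient of the curve polynomial by `nodePoly`. The remainder
`R` interpolates the `y_k²` with derivative `P'(x₁)`, and the other summands are the expansion of
`(R - a²)/nodePoly`, where `a` is the interpolant of the `y_k`. -/
theorem nodePoly_mul_redH (hy : y 0 ≠ 0) (hxy : ∀ k, y k ^ 2 = (curvePoly g lam).eval (x k)) :
    nodePoly g x * redH g lam x y =
      curvePoly g lam - hermite g x y (derivAt g lam x / (2 * y 0)) ^ 2 := by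
  have hp := tailProd_ne_zero hx
  have hd : derivAt g lam x = 2 * y 0 * (derivAt g lam x / (2 * y 0)) := by field_simp
  generalize hm : derivAt g lam x / (2 * y 0) = m at hd
  have hR : curvePoly g lam - nodePoly g x * curveQuot g lam x =
      hermite g x (fun k => y k ^ 2) (derivAt g lam x) := by
    have hv : (fun k => (curvePoly g lam - nodePoly g x * curveQuot g lam x).eval (x k)) =
        fun k => y k ^ 2 := by
      funext k
      have : (nodePoly g x).eval (x k) = 0 := by
        by_cases hk : k ∈ tail g
        · simp [nodePoly, eval_tailPoly_node hk]
        · rw [mem_tail, not_not] at hk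
          simp [nodePoly, hk]
      rw [eval_sub, eval_mul, this, zero_mul, sub_zero, hxy]
    have hv' : (derivative (curvePoly g lam - nodePoly g x * curveQuot g lam x)).eval (x 0) =
        derivAt g lam x := by
      simp [nodePoly, derivAt, derivative_mul, derivative_pow]
    rw [← hv, ← hv']
    exact eq_hermite hx (degree_curvePoly_sub_lt g lam x)
  have hone := partition_of_one hx
  have hdiv := mul_divByMonic_tailPoly (x := x)
  rw [redH, ← curveQuot]
  set t : ℂ[X] := X - C (x 0) with ht
  set T : ℂ[X] := tailPoly g x with hT
  set σ := invSum g x with hσ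
  set p := tailProd g x with hpdef
  set q := (T - C p) /ₘ t with hq
  set S₀ := ∑ k ∈ tail g, simpleTerm x k with hS₀
  set S₁ := ∑ k ∈ tail g, C (y k) * simpleTerm x k with hS₁
  set S₂ := ∑ k ∈ tail g, C (y k) ^ 2 * simpleTerm x k with hS₂
  have hCp : C p⁻¹ * C p = (1 : ℂ[X]) := by rw [← C_mul, inv_mul_cancel₀ hp, C_1]
  have h3 : ∑ k ∈ tail g, C (2 * y k / ((x k - x 0) * nodeProd g x k)) *
      (∏ i ∈ Finset.univ.erase k, (X - C (x i))) * t = 2 * S₁ := by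
    rw [hS₁, Finset.mul_sum]
    refine Finset.sum_congr rfl fun k hk => ?_
    rw [prod_erase_eq hk, simpleTerm, div_eq_mul_inv]
    simp only [C_mul, C_ofNat]
    ring
  have h4 : t ^ 2 * ∑ j ∈ tail g, C ((y 0 - y j) ^ 2 / ((x j - x 0) * nodeProd g x j * p)) *
      (∏ i ∈ (tail g).erase j, (X - C (x i))) * (1 - t * C σ) =
        C p⁻¹ * (C (y 0 ^ 2) * S₀ - 2 * C (y 0) * S₁ + S₂) * (1 - t * C σ) := by
    rw [hS₀, hS₁, hS₂, Finset.mul_sum, Finset.mul_sum, Finset.mul_sum, ← Finset.sum_sub_distrib,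
      ← Finset.sum_add_distrib, Finset.mul_sum, Finset.sum_mul]
    refine Finset.sum_congr rfl fun j hj => ?_
    rw [simpleTerm, div_eq_mul_inv, mul_inv (_ * _) p]
    simp only [C_mul, C_pow, C_sub]
    ring
  have h5 : t ^ 2 * T * ∑ k ∈ tail g, ∑ j ∈ (tail g).erase k,
      C ((y k ^ 2 - y k * y j) /
        ((x k - x 0) * (x j - x 0) * nodeProd g x k * nodeProd g x j)) *
        t ^ 2 * ∏ i ∈ ((tail g).erase k).erase j, (X - C (x i)) = S₂ * S₀ - S₁ * S₁ := by
    have h6 : S₂ * S₀ - S₁ * S₁ = ∑ k ∈ tail g, ∑ j ∈ tail g,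
        C (y k ^ 2 - y k * y j) * simpleTerm x k * simpleTerm x j := by
      rw [hS₀, hS₁, hS₂, Finset.sum_mul_sum, Finset.sum_mul_sum, ← Finset.sum_sub_distrib]
      refine Finset.sum_congr rfl fun k _ => ?_
      rw [← Finset.sum_sub_distrib]
      refine Finset.sum_congr rfl fun j _ => ?_
      simp only [C_mul, C_pow, C_sub]
      ring
    rw [h6, Finset.mul_sum]
    refine Finset.sum_congr rfl fun k hk => ?_
    -- The diagonal terms carry the factor `y_k² - y_k y_k = 0`, so the double sum over `k ≠ j` is
    -- the full product.
    rw [← Finset.add_sum_erase _ _ hk, Finset.mul_sum]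
    have h7 : C (y k ^ 2 - y k * y k) = (0 : ℂ[X]) := by rw [sq, sub_self, C_0]
    rw [h7, zero_mul, zero_mul, zero_add]
    refine Finset.sum_congr rfl fun j hj => ?_
    have hj' := Finset.mem_erase.1 hj
    have hkj : k ∈ (tail g).erase j := Finset.mem_erase.2 ⟨hj'.1.symm, hk⟩
    rw [simpleTerm, simpleTerm, hT, tailPoly_eq hk, ← Finset.mul_prod_erase _ _ hj,
      ← Finset.mul_prod_erase _ _ hkj, Finset.erase_right_comm (a := j) (b := k), div_eq_mul_inv,
      show (x k - x 0) * (x j - x 0) * nodeProd g x k * nodeProd g x j =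
        ((x k - x 0) * nodeProd g x k) * ((x j - x 0) * nodeProd g x j) by ring, mul_inv]
    simp only [C_mul]
    ring
  have hN : nodePoly g x = t ^ 2 * T := rfl
  rw [hermite_eq] at hR
  rw [hermite_eq, hN]
  rw [hN] at hR
  have e1 : derivAt g lam x / p ^ 2 = 2 * y 0 * m * p⁻¹ * p⁻¹ := by
    rw [hd]; field_simp
  have e2 : derivAt g lam x / (2 * y 0 * p) = m * p⁻¹ := by
    rw [hd]; field_simp
  have e3 : m / p = m * p⁻¹ := rfl
  have h3' : (∑ k ∈ tail g, C (2 * y k / ((x k - x 0) * nodeProd g x k)) *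
      (∏ i ∈ Finset.univ.erase k, (X - C (x i)))) * t = 2 * S₁ := by
    rw [Finset.sum_mul]; exact h3
  rw [e1, e2, hm, e3]
  rw [hd] at hR
  simp only [C_mul, C_pow, C_sub, C_ofNat, ← hS₁] at hR h4 ⊢
  rw [← hS₂] at hR
  -- `R` is linear in the interpolation terms and `a²` quadratic; the multiple of `hone` homogenizes
  -- `R` by inserting the partition of one.
  linear_combination (-1 : ℂ[X]) * hR - t * T * C m * C p⁻¹ * h3' + T * h4 + h5 -
    2 * C (y 0) * C m * C p⁻¹ ^ 2 * t * T * hdiv + 2 * C (y 0) * C m * C p⁻¹ * t * T * hCp +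
    (S₂ + C (y 0) ^ 2 * C p⁻¹ * T * (1 - t * C σ)) * hone

theorem redH_monic_and_natDegree (hlam : lam 0 = 1) (hy : y 0 ≠ 0)
    (hxy : ∀ k, y k ^ 2 = (curvePoly g lam).eval (x k)) :
    (redH g lam x y).Monic ∧ (redH g lam x y).natDegree = g := by
  have h := nodePoly_mul_redH hx hy hxy
  have hdeg : (hermite g x y (derivAt g lam x / (2 * y 0)) ^ 2).natDegree <
      (curvePoly g lam).natDegree := by
    rw [natDegree_curvePoly hlam, natDegree_pow]
    have := natDegree_hermite_le (x := x) y (derivAt g lam x / (2 * y 0))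
    omega
  have hm : (nodePoly g x * redH g lam x y).Monic := by
    rw [h]
    exact (monic_curvePoly hlam).sub_of_left (degree_lt_degree hdeg)
  have hm' := (monic_nodePoly g x).of_mul_monic_left hm
  refine ⟨hm', ?_⟩
  have h2 := congrArg natDegree h
  rw [natDegree_sub_eq_left_of_natDegree_lt hdeg, (monic_nodePoly g x).natDegree_mul hm',
    natDegree_nodePoly, natDegree_curvePoly hlam] at h2
  omega

omit hx in
/-- `ℐ` is the remainder of the interpolation polynomial modulo `ℋ`. -/
theorem redI_eq :
    redI g lam x y = hermite g x y (derivAt g lam x / (2 * y 0)) -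
      C ((derivAt g lam x / (2 * y 0) - y 0 * invSum g x) / tailProd g x +
        ∑ k ∈ tail g, y k / ((x k - x 0) * nodeProd g x k)) * redH g lam x y := by
  rw [redI, hermite]
  simp only [mul_sub, Finset.sum_sub_distrib, ← Finset.sum_mul, C_add, add_mul, map_sum,
    div_eq_mul_inv, C_mul, C_sub]
  ring

omit hx in
-- Apart from a multiple of `tailPoly`, of degree `g - 1`, every summand is a constant times a
-- difference of two monic polynomials of degree `g`.
theorem degree_redI_lt (hm : (redH g lam x y).Monic) (hd : (redH g lam x y).natDegree = g) :
    (redI g lam x y).degree < (g : WithBot ℕ) := by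
  have hg := NeZero.pos g
  have hdeg : (redH g lam x y).degree = (g : WithBot ℕ) := by
    rw [degree_eq_natDegree hm.ne_zero, hd]
  have hT : (tailPoly g x).degree < (g : WithBot ℕ) := by
    rw [degree_eq_natDegree (monic_tailPoly g x).ne_zero, natDegree_tailPoly]
    exact_mod_cast Nat.sub_lt hg one_pos
  have key : ∀ q : ℂ[X], q.Monic → q.natDegree = g → ∀ c : ℂ,
      (C c * (q - redH g lam x y)).degree < (g : WithBot ℕ) := by
    intro q hq hqd c
    refine (degree_const_mul_le _ _).trans_lt ?_
    have hqd' : q.degree = (g : WithBot ℕ) := by rw [degree_eq_natDegree hq.ne_zero, hqd]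
    have := degree_sub_lt_left (hqd'.trans hdeg.symm) hq.ne_zero (hq.leadingCoeff.trans hm.symm)
    exact this.trans_eq hqd'
  rw [redI]
  refine (degree_add_le _ _).trans_lt (max_lt ((degree_add_le _ _).trans_lt (max_lt ?_ ?_)) ?_)
  · refine key _ ((monic_X_sub_C _).mul (monic_tailPoly g x)) ?_ _
    rw [(monic_X_sub_C _).natDegree_mul (monic_tailPoly g x), natDegree_X_sub_C,
      natDegree_tailPoly]
    omega
  · exact (degree_const_mul_le _ _).trans_lt hT
  · refine (degree_sum_le _ _).trans_lt ((Finset.sup_lt_iff (WithBot.bot_lt_coe g)).2 fun k _ => ?_)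
    have hmon : (∏ i ∈ Finset.univ.erase k, (X - C (x i))).Monic :=
      monic_prod_of_monic _ _ fun _ _ => monic_X_sub_C _
    refine key _ ((monic_X_sub_C _).mul hmon) ?_ _
    rw [(monic_X_sub_C _).natDegree_mul hmon, natDegree_X_sub_C,
      natDegree_prod_of_monic _ _ fun _ _ => monic_X_sub_C _]
    simp
    omega

end Nodes

/-! ### Divisors -/

/-- Multiplying both functions by the conjugate of `v` replaces `v` by its norm, a polynomial in
`x`. -/
theorem dvd_of_forall_ordAt_le (hodd : Odd P.natDegree) (hsq : Squarefree P) {u v : CoordRing P}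
    (hu : u ≠ 0) (hv : v ≠ 0) (h : ∀ Q, ordAt Q v ≤ ordAt Q u) : v ∣ u := by
  have := noZeroDivisors_coordRing hodd
  obtain ⟨c, d, rfl⟩ := exists_eq_regFun v
  have hN := normPoly_ne_zero hodd hv
  have hN' : regFun P (normPoly P c d) 0 ≠ 0 := by simpa [regFun_eq_zero_iff] using hN
  have hconj : regFun P c (-d) ≠ 0 := by simpa [regFun_eq_zero_iff] using hv
  have hle : ∀ Q, ordAt Q (regFun P (normPoly P c d) 0) ≤ ordAt Q (u * regFun P c (-d)) := by
    intro Q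
    rw [← regFun_mul_conj, ordAt_mul hodd hsq Q hv hconj, ordAt_mul hodd hsq Q hu hconj]
    exact Nat.add_le_add_right (h Q) _
  obtain ⟨f, hf⟩ := dvd_of_ordAt_le hodd hsq hN (mul_ne_zero hu hconj) hle
  refine ⟨f, mul_left_cancel₀ hconj ?_⟩
  rw [← regFun_mul_conj] at hf
  linear_combination hf

theorem poleOrder_eq_of_mul_eq (hodd : Odd P.natDegree) {a b c d a' b' c' d' : ℂ[X]}
    (h₁ : regFun P a b ≠ 0) (h₂ : regFun P c d ≠ 0) (h₃ : regFun P a' b' ≠ 0)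
    (h₄ : regFun P c' d' ≠ 0)
    (h : regFun P a b * regFun P c d = regFun P a' b' * regFun P c' d') :
    poleOrder P a b + poleOrder P c d = poleOrder P a' b' + poleOrder P c' d' := by
  rw [regFun_mul, regFun_mul, regFun_inj] at h
  rw [← poleOrder_mul hodd h₁ h₂, ← poleOrder_mul hodd h₃ h₄, h.1, h.2]

open Classical in
theorem toDivisor_some (D : Multiset (AffPoint P)) (Q : AffPoint P) :
    toDivisor D (some Q) = D.count Q := by
  induction D using Multiset.induction_on with
  | empty => simp [toDivisor]
  | cons R D ih =>
    have : toDivisor (R ::ₘ D) = Finsupp.single (some R) (1 : ℤ) + toDivisor D := by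
      simp [toDivisor]
    rw [this, Finsupp.add_apply, ih, Finsupp.single_apply, Multiset.count_cons]
    simp only [Option.some.injEq, eq_comm (a := R)]
    split_ifs <;> push_cast <;> ring

theorem toDivisor_inf (D : Multiset (AffPoint P)) : toDivisor D (infPt P) = 0 := by
  induction D using Multiset.induction_on with
  | empty => simp [toDivisor]
  | cons R D ih =>
    have : toDivisor (R ::ₘ D) = Finsupp.single (some R) (1 : ℤ) + toDivisor D := by
      simp [toDivisor]
    rw [this, Finsupp.add_apply, ih, Finsupp.single_apply]
    simp

theorem deg_toDivisor (D : Multiset (AffPoint P)) : (toDivisor D).deg = Multiset.card D := by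
  induction D using Multiset.induction_on with
  | empty => simp [toDivisor, Divisor.deg]
  | cons R D ih =>
    have : toDivisor (R ::ₘ D) = Finsupp.single (some R) (1 : ℤ) + toDivisor D := by
      simp [toDivisor]
    rw [this, Divisor.deg, Finsupp.sum_add_index' (fun _ => rfl) (fun _ _ _ => rfl),
      Finsupp.sum_single_index rfl, Multiset.card_cons]
    change (1 : ℤ) + (toDivisor D).deg = _
    rw [ih]
    push_cast
    ring

theorem infDiv_some (n : ℤ) (Q : AffPoint P) : infDiv P n (some Q) = 0 := by
  simp [infDiv, infPt]

theorem infDiv_inf (n : ℤ) : infDiv P n (infPt P) = n := by simp [infDiv]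

@[simp] theorem invol_invol (Q : AffPoint P) : Q.invol.invol = Q := by
  ext <;> simp [AffPoint.invol]

/-- The monic polynomial in `x` with roots at the abscissas of the points of `D`. -/
def xPoly (D : Multiset (AffPoint P)) : ℂ[X] := (D.map fun Q => X - C Q.x).prod

theorem monic_xPoly (D : Multiset (AffPoint P)) : (xPoly D).Monic :=
  monic_multiset_prod_of_monic _ _ fun _ _ => monic_X_sub_C _

theorem roots_xPoly (D : Multiset (AffPoint P)) : (xPoly D).roots = D.map AffPoint.x := by
  have : D.map (fun Q => X - C Q.x) = (D.map AffPoint.x).map fun r => X - C r := by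
    rw [Multiset.map_map]
    rfl
  rw [xPoly, this, roots_multiset_prod_X_sub_C]

theorem natDegree_xPoly (D : Multiset (AffPoint P)) : (xPoly D).natDegree = Multiset.card D := by
  rw [xPoly, natDegree_multiset_prod_of_monic]
  · simp
  · intro p hp
    obtain ⟨Q, -, rfl⟩ := Multiset.mem_map.1 hp
    exact monic_X_sub_C _

theorem regFun_xPoly_ne_zero (D : Multiset (AffPoint P)) : regFun P (xPoly D) 0 ≠ 0 := by
  simpa [regFun_eq_zero_iff] using (monic_xPoly D).ne_zero

open Classical in
-- On a graph a point is determined by its abscissa, so multiplicities of points become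
-- multiplicities of roots.
theorem count_map_x {D : Multiset (AffPoint P)} {a : ℂ[X]} (hD : ∀ R ∈ D, R.y = a.eval R.x)
    (Q : AffPoint P) :
    D.count Q = if Q.y = a.eval Q.x then (D.map AffPoint.x).count Q.x else 0 := by
  split_ifs with h
  · rw [Multiset.count_map, Multiset.count_eq_card_filter_eq]
    congr 1
    refine Multiset.filter_congr fun R hR => ⟨fun h => h ▸ rfl, fun hx => ?_⟩
    exact AffPoint.ext hx (by rw [h, hD R hR, hx])
  · exact Multiset.count_eq_zero.2 fun hQ => h (hD Q hQ)

open Classical in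
-- Each factor `x - x_R` has finite zeros `R + ιR`, which is `2R` at a branch point.
theorem ordAt_xPoly (hodd : Odd P.natDegree) (hsq : Squarefree P) (D : Multiset (AffPoint P))
    (Q : AffPoint P) :
    ordAt Q (regFun P (xPoly D) 0) = D.count Q + D.count Q.invol := by
  induction D using Multiset.induction_on with
  | empty =>
    rw [ordAt_poly hodd hsq Q (monic_xPoly _).ne_zero,
      show xPoly (0 : Multiset (AffPoint P)) = C 1 by simp [xPoly], rootMultiplicity_C]
    simp
  | cons R D ih =>
    have h1 : regFun P (xPoly (R ::ₘ D)) 0 = regFun P (X - C R.x) 0 * regFun P (xPoly D) 0 := by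
      rw [regFun_poly_mul, mul_zero]
      simp [xPoly]
    have h2 : regFun P (X - C R.x) 0 ≠ 0 := by
      simpa [regFun_eq_zero_iff] using X_sub_C_ne_zero R.x
    rw [h1, ordAt_mul hodd hsq Q h2 (regFun_xPoly_ne_zero D), ih,
      ordAt_poly hodd hsq Q (X_sub_C_ne_zero _), rootMultiplicity_X_sub_C, Multiset.count_cons,
      Multiset.count_cons]
    suffices h : (if Q.x = R.x then 1 else 0) * (if Q.y = 0 then 2 else 1) =
        (if Q = R then 1 else 0) + (if Q.invol = R then 1 else 0) by omega
    by_cases hx : Q.x = R.x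
    · have hy : Q.y = R.y ∨ Q.y = -R.y := by
        rw [← sq_eq_sq_iff_eq_or_eq_neg, Q.on_curve, R.on_curve, hx]
      have e1 : Q = R ↔ Q.y = R.y := ⟨fun h => h ▸ rfl, fun h => AffPoint.ext hx h⟩
      have e2 : Q.invol = R ↔ -Q.y = R.y :=
        ⟨fun h => h ▸ rfl, fun h => AffPoint.ext hx h⟩
      rw [if_pos hx, one_mul]
      simp only [e1, e2]
      by_cases h0 : Q.y = 0
      · have : R.y = 0 := by rcases hy with h | h <;> simpa [h0, eq_comm] using h
        simp [h0, this]
      · rw [if_neg h0]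
        rcases hy with h | h
        · have : ¬ -Q.y = R.y := fun h' => h0 (by linear_combination (h - h') / 2)
          rw [if_pos h, if_neg this]
        · have : ¬ Q.y = R.y := fun h' => h0 (by linear_combination (h + h') / 2)
          rw [if_neg this, if_pos (by rw [h, neg_neg])]
    · have e1 : Q ≠ R := fun h => hx (h ▸ rfl)
      have e2 : Q.invol ≠ R := fun h => hx (h ▸ rfl)
      rw [if_neg hx, if_neg e1, if_neg e2, zero_mul, add_zero]

/-! ### Reduction along a graph `y = a(x)` -/

section Graph

variable {D M : Multiset (AffPoint P)} {a H : ℂ[X]} (hodd : Odd P.natDegree)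
  (hsq : Squarefree P)
include hodd hsq

theorem ordAt_add_y_of_branch (a : ℂ[X]) {Q : AffPoint P} (hy : Q.y = 0)
    (ha : a.eval Q.x = 0) : ordAt Q (regFun P a 1) = 1 := by
  rw [ordAt_add_y hodd hsq, if_pos (by rw [ha, hy, add_zero])]
  have hne : a ^ 2 - P ≠ 0 := by
    have := normPoly_ne_zero hodd (P := P) (a := a) (b := 1) (by simp [regFun_eq_zero_iff])
    simpa [normPoly] using this
  have hr : P.eval Q.x = 0 := by rw [← Q.on_curve, hy]; ring
  have h1 : 0 < (a ^ 2 - P).rootMultiplicity Q.x :=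
    (rootMultiplicity_pos hne).2 (by simp [IsRoot, ha, hr])
  have h2 : ¬ 1 < (a ^ 2 - P).rootMultiplicity Q.x := by
    rw [one_lt_rootMultiplicity_iff_isRoot hne]
    rintro ⟨-, h⟩
    refine eval_deriv_ne_zero hsq Q hy ?_
    simpa [IsRoot, derivative_pow, ha] using h
  omega

open Classical in
/-- A polynomial in `x` that vanishes on `ι D` and is of degree less than `deg D` is zero. -/
theorem eq_zero_of_count_le_ordAt (hD : ∀ R ∈ D, R.y = a.eval R.x)
    (hpair : ∀ Q : AffPoint P, ¬ ({Q, Q.invol} : Multiset (AffPoint P)) ≤ D) {p : ℂ[X]}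
    (hdeg : p.natDegree < Multiset.card D)
    (h : p ≠ 0 → ∀ Q : AffPoint P, D.count Q.invol ≤ ordAt Q (regFun P p 0)) : p = 0 := by
  by_contra hp
  refine absurd hdeg (not_lt.2 ?_)
  refine le_trans ?_ (card_roots' p)
  rw [← Multiset.card_map AffPoint.x D]
  refine Multiset.card_le_card (Multiset.le_iff_count.2 fun r => ?_)
  by_cases hr : r ∈ D.map AffPoint.x
  · obtain ⟨R, hR, rfl⟩ := Multiset.mem_map.1 hr
    have h1 := h hp R.invol
    have h2 := count_map_x hD R
    rw [if_pos (hD R hR)] at h2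
    rw [invol_invol, ordAt_poly hodd hsq _ hp] at h1
    -- At a branch point the order is twice the root multiplicity, which suffices because there `D`,
    -- containing no pair, has multiplicity at most one.
    have h3 : D.count R ≤ p.rootMultiplicity R.x := by
      by_cases hy : R.y = 0
      · have h4 : D.count R < 2 := by
          by_contra! hc
          rw [Multiset.le_count_iff_replicate_le] at hc
          refine hpair R ?_
          have : R.invol = R := AffPoint.ext rfl (by simp [AffPoint.invol, hy])
          rw [this]
          exact hc
        simp only [AffPoint.invol, hy, neg_zero, if_true] at h1
        omega
      · simpa [AffPoint.invol, hy] using h1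
    rw [count_roots]
    exact h2.symm.trans_le h3
  · rw [Multiset.count_eq_zero_of_notMem hr]
    exact Nat.zero_le _

open Classical in
-- The norm of `y + a` is `-xPoly D * xPoly M`, and at a zero of `y + a` the order is the root
-- multiplicity of the norm. The zeros lie on `y = -a`, which contains `M` and `ιD`.
theorem ordAt_graph (hD : ∀ R ∈ D, R.y = a.eval R.x)
    (hM : ∀ R ∈ M, R.y = (-a).eval R.x) (hMD : xPoly D * xPoly M = P - a ^ 2) (Q : AffPoint P) :
    ordAt Q (regFun P a 1) = M.count Q + D.count Q.invol := by
  classical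
  have h1 := count_map_x hM Q
  have h2 := count_map_x hD Q.invol
  have e1 : Q.y = (-a).eval Q.x ↔ a.eval Q.x + Q.y = 0 := by
    rw [eval_neg, eq_neg_iff_add_eq_zero, add_comm]
  have e2 : Q.invol.y = a.eval Q.invol.x ↔ a.eval Q.x + Q.y = 0 := by
    simp only [AffPoint.invol]
    rw [neg_eq_iff_add_eq_zero, add_comm]
  have h3 : M.count Q + D.count Q.invol =
      if a.eval Q.x + Q.y = 0 then
        (M.map AffPoint.x).count Q.x + (D.map AffPoint.x).count Q.x else 0 := by
    rw [if_congr e1 rfl rfl] at h1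
    rw [if_congr e2 rfl rfl] at h2
    rw [h1, h2]
    split_ifs <;> rfl
  rw [ordAt_add_y hodd hsq, h3]
  congr 1
  have h4 : a ^ 2 - P = C (-1) * (xPoly D * xPoly M) := by rw [hMD]; simp
  rw [← roots_xPoly, ← roots_xPoly, ← Multiset.count_add, add_comm,
    ← roots_mul (mul_ne_zero (monic_xPoly D).ne_zero (monic_xPoly M).ne_zero), ← count_roots, h4,
    roots_C_mul _ (by norm_num)]

/-- The function is `(y + a)/xPoly D`: the zeros `ιD` cancel, and the pole orders at infinity are
`2g+1` and `2g+2`. -/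
theorem isReductionOf_graph {g : ℕ} (hP : P.natDegree = 2 * g + 1) (ha : a.natDegree ≤ g)
    (hDc : Multiset.card D = g + 1) (hMc : Multiset.card M = g)
    (hD : ∀ R ∈ D, R.y = a.eval R.x) (hM : ∀ R ∈ M, R.y = (-a).eval R.x)
    (hMD : xPoly D * xPoly M = P - a ^ 2) : IsReductionOf g D (toDivisor M) := by
  classical
  refine ⟨?_, ?_, a, 1, xPoly D, 0, ?_, regFun_xPoly_ne_zero D, fun Q => ?_, ?_⟩
  · rintro (_ | Q)
    · exact (toDivisor_inf M).ge
    · rw [toDivisor_some]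
      exact Int.natCast_nonneg _
  · rw [deg_toDivisor, hMc]
  · simp [regFun_eq_zero_iff]
  · simp only [Finsupp.sub_apply, toDivisor_some, infDiv_some]
    rw [ordAt_graph hodd hsq hD hM hMD, ordAt_xPoly hodd hsq]
    push_cast
    ring
  · simp only [Finsupp.sub_apply, toDivisor_inf, infDiv_inf]
    rw [poleOrder_poly, natDegree_xPoly, hDc, poleOrder, if_neg one_ne_zero, natDegree_one, hP,
      max_eq_right (by omega)]
    push_cast
    ring

theorem eq_toDivisor_of_isReductionOf {g : ℕ} (hP : P.natDegree = 2 * g + 1)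
    (ha : a.natDegree ≤ g) (hDc : Multiset.card D = g + 1)
    (hD : ∀ R ∈ D, R.y = a.eval R.x) (hM : ∀ R ∈ M, R.y = (-a).eval R.x)
    (hMD : xPoly D * xPoly M = P - a ^ 2)
    (hpair : ∀ Q : AffPoint P, ¬ ({Q, Q.invol} : Multiset (AffPoint P)) ≤ D)
    {D' : Divisor P} (hD' : IsReductionOf g D D') : D' = toDivisor M := by
  classical
  obtain ⟨hpos, -, a₁, b₁, c₁, d₁, hu, hv, hord, hinf⟩ := hD'
  simp only [Finsupp.sub_apply, toDivisor_some, toDivisor_inf, infDiv_some, infDiv_inf] at hord hinf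
  have := noZeroDivisors_coordRing hodd
  have hh := regFun_xPoly_ne_zero D
  have hord' : ∀ Q, (ordAt Q (regFun P a₁ b₁ * regFun P (xPoly D) 0) : ℤ) =
      ordAt Q (regFun P c₁ d₁) + D' (some Q) + D.count Q.invol := by
    intro Q
    rw [ordAt_mul hodd hsq Q hu hh, ordAt_xPoly hodd hsq]
    have := hord Q
    push_cast
    linarith
  -- Multiplication by `xPoly D` clears the poles at `D` at the cost of zeros at `ιD`; `f` has
  -- finite zeros `D' + ιD`.
  obtain ⟨f, hf⟩ := dvd_of_forall_ordAt_le hodd hsq (mul_ne_zero hu hh) hv fun Q => by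
    have h1 := hord' Q
    have h2 : (0 : ℤ) ≤ D' (some Q) := hpos (some Q)
    omega
  have hf0 : f ≠ 0 := by
    rintro rfl
    rw [mul_zero] at hf
    exact mul_ne_zero hu hh hf
  have hordf : ∀ Q, (ordAt Q f : ℤ) = D' (some Q) + D.count Q.invol := by
    intro Q
    have h1 := hord' Q
    rw [hf, ordAt_mul hodd hsq Q hv hf0] at h1
    push_cast at h1
    linarith
  have hle : ∀ Q, D.count Q.invol ≤ ordAt Q f := by
    intro Q
    have h1 := hordf Q
    have h2 : (0 : ℤ) ≤ D' (some Q) := hpos (some Q)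
    omega
  obtain ⟨a', b', rfl⟩ := exists_eq_regFun f
  have hpole := poleOrder_eq_of_mul_eq hodd hu hh hv hf0 hf
  rw [poleOrder_poly, natDegree_xPoly, hDc] at hpole
  have hinf0 : (0 : ℤ) ≤ D' (infPt P) := hpos _
  have hpf : (poleOrder P a' b' : ℤ) = 2 * g + 1 - D' (infPt P) := by
    rw [hDc] at hinf
    push_cast at hinf
    have : (poleOrder P a₁ b₁ : ℤ) + 2 * (g + 1) = poleOrder P c₁ d₁ + poleOrder P a' b' := by
      exact_mod_cast hpole
    linarith
  -- Otherwise `f` would be a polynomial in `x` with `2 deg a' ≤ 2g + 1`, too small a degree to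
  -- vanish on `ιD`.
  have hb' : b' ≠ 0 := by
    rintro rfl
    rw [poleOrder_poly] at hpf
    have : a' = 0 := eq_zero_of_count_le_ordAt hodd hsq hD hpair (by omega) fun _ => hle
    rw [this, regFun_zero] at hf0
    exact hf0 rfl
  rw [poleOrder, if_neg hb', hP] at hpf
  have hmax1 := le_max_left (2 * a'.natDegree) (2 * b'.natDegree + (2 * g + 1))
  have hmax2 := le_max_right (2 * a'.natDegree) (2 * b'.natDegree + (2 * g + 1))
  -- The term in `y` alone already has a pole of order `2g + 1`, the largest allowed; so `D'` avoids
  -- infinity and `b'` is constant.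
  have hDinf : D' (infPt P) = 0 := by omega
  obtain ⟨β, rfl⟩ := natDegree_eq_zero.1 (show b'.natDegree = 0 by omega)
  have hβ : β ≠ 0 := by rintro rfl; simp at hb'
  have hCβ : C β⁻¹ * C β = (1 : ℂ[X]) := by rw [← C_mul, inv_mul_cancel₀ hβ, C_1]
  have hy0 : regFun P a 1 ≠ 0 := by simp [regFun_eq_zero_iff]
  have hp : C β⁻¹ * a' - a = 0 := by
    refine eq_zero_of_count_le_ordAt hodd hsq hD hpair ?_ fun hne Q => ?_
    · refine (natDegree_sub_le _ _).trans_lt (max_lt ?_ (by omega))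
      exact (natDegree_C_mul_le _ _).trans_lt (by omega)
    · rw [le_ordAt_iff hodd hsq Q (by simpa [regFun_eq_zero_iff] using hne)]
      have h1 : regFun P (C β⁻¹ * a' - a) 0 =
          regFun P (C β⁻¹) 0 * regFun P a' (C β) + regFun P (-1) 0 * regFun P a 1 := by
        rw [regFun_poly_mul, regFun_poly_mul, regFun_add, regFun_inj, hCβ]
        constructor <;> ring
      rw [h1]
      refine add_mem (Ideal.mul_mem_left _ _ ?_) (Ideal.mul_mem_left _ _ ?_)
      · exact (le_ordAt_iff hodd hsq Q hf0 _).1 (hle Q)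
      · refine (le_ordAt_iff hodd hsq Q hy0 _).1 ?_
        rw [ordAt_graph hodd hsq hD hM hMD]
        exact Nat.le_add_left _ _
  have ha' : a' = C β * a := by
    linear_combination C β * hp - a' * hCβ
  ext Q
  rcases Q with _ | Q
  · exact hDinf.trans (toDivisor_inf M).symm
  · have h1 := hordf Q
    have h2 : regFun P a' (C β) = regFun P (C β) 0 * regFun P a 1 := by
      rw [regFun_poly_mul, ha', mul_one]
    have h3 : regFun P (C β) 0 ≠ 0 := by simpa [regFun_eq_zero_iff] using hβ
    rw [h2, ordAt_mul hodd hsq Q h3 hy0, ordAt_poly hodd hsq Q (by simpa using hβ),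
      rootMultiplicity_C, zero_mul, zero_add, ordAt_graph hodd hsq hD hM hMD] at h1
    rw [toDivisor_some]
    push_cast at h1
    linarith

/-- At a non-branch point of `M` the order of `H = xPoly M` is the multiplicity in `M`, and `y + a -
cH` vanishes at least as much. At a branch point of `M` that multiplicity is one: `H` vanishes to
order two, but `y + a - cH` only to order one, so the minimum is still right. At `ιR` for `R` in
`M`, unless it lies on `y = -a`, the second function does not vanish. -/
theorem definedBySystem_graph (hD : ∀ R ∈ D, R.y = a.eval R.x)
    (hM : ∀ R ∈ M, R.y = (-a).eval R.x) (hMD : xPoly D * xPoly M = P - a ^ 2) (c : ℂ) :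
    DefinedBySystem (toDivisor M) (xPoly M) (-(a - C c * xPoly M)) := by
  classical
  have hH := (monic_xPoly M).ne_zero
  refine ⟨hH, toDivisor_inf M, fun Q => ?_⟩
  rw [neg_neg, toDivisor_some, Nat.cast_inj, ordAt_poly hodd hsq Q hH]
  have hcount := count_map_x hM Q
  have hgraph := ordAt_graph hodd hsq hD hM hMD Q
  rw [← roots_xPoly, count_roots] at hcount
  by_cases hs : a.eval Q.x + Q.y = 0
  · rw [if_pos (by rw [eval_neg]; linear_combination hs)] at hcount
    by_cases hy : Q.y = 0
    · have ha : a.eval Q.x = 0 := by simpa [hy] using hs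
      rw [ordAt_add_y_of_branch hodd hsq a hy ha] at hgraph
      rw [if_pos hy, ← hcount]
      rcases Nat.eq_zero_or_pos (M.count Q) with h0 | h0
      · rw [h0, zero_mul, Nat.zero_min]
      · have h1 : M.count Q = 1 := by omega
        have hr : (xPoly M).eval Q.x = 0 :=
          (rootMultiplicity_pos hH).1 (by rw [← hcount]; exact h0)
        rw [h1, ordAt_add_y_of_branch hodd hsq _ hy (by simp [ha, hr])]
        rfl
    · rw [if_neg hy, mul_one, ← hcount, min_eq_left]
      rw [le_ordAt_iff hodd hsq Q (by simp [regFun_eq_zero_iff])]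
      have h1 : regFun P (a - C c * xPoly M) 1 =
          regFun P a 1 + regFun P (C (-c)) 0 * regFun P (xPoly M) 0 := by
        rw [regFun_poly_mul, regFun_add, regFun_inj, C_neg]
        constructor <;> ring
      rw [h1]
      refine add_mem ?_ (Ideal.mul_mem_left _ _ ?_)
      · rw [← le_ordAt_iff hodd hsq Q (by simp [regFun_eq_zero_iff]), hgraph]
        exact Nat.le_add_right _ _
      · rw [← le_ordAt_iff hodd hsq Q (regFun_xPoly_ne_zero M), ordAt_xPoly hodd hsq]
        exact Nat.le_add_right _ _
  · rw [if_neg (by rw [eval_neg]; intro h; exact hs (by linear_combination h))] at hcount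
    rw [hcount]
    by_cases hr : (xPoly M).eval Q.x = 0
    · have hI : ¬ (a - C c * xPoly M).eval Q.x + Q.y = 0 := by
        rwa [eval_sub, eval_mul, hr, mul_zero, sub_zero]
      rw [ordAt_add_y hodd hsq, if_neg hI, Nat.min_zero]
    · rw [rootMultiplicity_eq_zero hr, zero_mul, Nat.zero_min]

end Graph

theorem exists_points_on_graph {a H : ℂ[X]} (hH : H.Monic) (hdvd : H ∣ P - a ^ 2) :
    ∃ M : Multiset (AffPoint P), (∀ R ∈ M, R.y = a.eval R.x) ∧ xPoly M = H := by
  have hon : ∀ r ∈ H.roots, (a.eval r) ^ 2 = P.eval r := by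
    intro r hr
    have h1 : (P - a ^ 2).eval r = 0 := by
      obtain ⟨q, hq⟩ := hdvd
      rw [hq, eval_mul, (mem_roots hH.ne_zero).1 hr, zero_mul]
    rw [eval_sub, eval_pow] at h1
    linear_combination -h1
  refine ⟨H.roots.pmap (fun r h => ⟨r, a.eval r, h⟩) hon, ?_, ?_⟩
  · intro R hR
    obtain ⟨r, hr, rfl⟩ := Multiset.mem_pmap.1 hR
    rfl
  · rw [xPoly, Multiset.map_pmap]
    refine (congrArg _ (Multiset.pmap_eq_map _ (fun r => X - C r) _ _)).trans ?_
    exact (prod_multiset_X_sub_C_of_monic_of_roots_card_eq hH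
      (splits_iff_card_roots.1 (IsAlgClosed.splits H)))

/-! ### Consequences of non-speciality for the points of `D`. -/

section NonSpecialSums

variable {g : ℕ} [NeZero g] {Pt : Fin g → AffPoint P} {D : Multiset (AffPoint P)}
  (hD : D = {Pt 0, Pt 0} + (tail g).val.map Pt)
include hD

theorem card_doubled : Multiset.card D = g + 1 := by
  have := NeZero.pos g
  have h := card_tail g
  rw [hD, Multiset.card_add, Multiset.card_map, Finset.card_val, h]
  simp
  omega

/-- `D` has `g + 1` points and each deletion removes two, so a truncation with at least `g` points
is `D` itself. -/
theorem not_pair_le (hns : NonSpecial g D) (Q : AffPoint P) :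
    ¬ ({Q, Q.invol} : Multiset (AffPoint P)) ≤ D := by
  obtain ⟨T, ⟨⟨E, hE⟩, hT⟩, hcard⟩ := hns
  have h1 := congrArg Multiset.card hE
  rw [card_doubled hD, Multiset.card_add, Multiset.card_add, Multiset.card_map] at h1
  have h2 : E = 0 := Multiset.card_eq_zero.1 (by omega)
  rw [h2, Multiset.map_zero, add_zero, add_zero] at hE
  rw [hE]
  exact hT Q

theorem univ_map_le : Finset.univ.val.map Pt ≤ D := by
  have h : (Finset.univ : Finset (Fin g)).val = 0 ::ₘ (tail g).val := by
    rw [tail, Finset.erase_val, Multiset.cons_erase (Finset.mem_univ _)]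
  rw [hD, h, Multiset.map_cons, ← Multiset.singleton_add, Multiset.insert_eq_cons,
    ← Multiset.singleton_add, add_assoc]
  exact Multiset.le_add_left _ _

theorem y_ne_zero_of_nonSpecial (hns : NonSpecial g D) : (Pt 0).y ≠ 0 := by
  intro h0
  refine not_pair_le hD hns (Pt 0) ?_
  have : (Pt 0).invol = Pt 0 := AffPoint.ext rfl (by simp [AffPoint.invol, h0])
  rw [this, hD]
  exact Multiset.le_add_right _ _

theorem injective_x_of_nonSpecial (hPt : Function.Injective Pt) (hns : NonSpecial g D) :
    Function.Injective fun k => (Pt k).x := by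
  intro i j hij
  by_contra hne
  have hx : (Pt i).x = (Pt j).x := hij
  have hy : (Pt j).y = (Pt i).y ∨ (Pt j).y = -(Pt i).y := by
    rw [← sq_eq_sq_iff_eq_or_eq_neg, (Pt j).on_curve, (Pt i).on_curve, hx]
  rcases hy with hy | hy
  · exact hne (hPt (AffPoint.ext hx hy.symm))
  · have h1 : (Pt i).invol = Pt j := AffPoint.ext hx hy.symm
    refine not_pair_le hD hns (Pt i) (le_trans ?_ (univ_map_le hD))
    rw [h1]
    have h2 : ({i, j} : Multiset (Fin g)) ≤ Finset.univ.val := by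
      rw [Multiset.le_iff_subset (by simpa using hne)]
      exact fun k _ => Finset.mem_univ k
    simpa using Multiset.map_le_map (f := Pt) h2

theorem xPoly_doubled : xPoly D = nodePoly g fun k => (Pt k).x := by
  rw [xPoly, hD, nodePoly, tailPoly, Multiset.map_add, Multiset.prod_add, Multiset.map_map,
    sq]
  simp only [Function.comp_def, Finset.prod_map_val]
  simp

end NonSpecialSums

end HyperellipticReduction

end

theorem theorem3p3 (g : ℕ) [NeZero g] (lam : ℕ → ℂ) (hlam : lam 0 = 1)
    (hsq : Squarefree (HyperellipticReduction.curvePoly g lam))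
    (Pt : Fin g → HyperellipticReduction.AffPoint (HyperellipticReduction.curvePoly g lam))
    (hPt : Function.Injective Pt)
    (D : Multiset (HyperellipticReduction.AffPoint (HyperellipticReduction.curvePoly g lam)))
    (hD : D = {Pt 0, Pt 0} + (HyperellipticReduction.tail g).val.map Pt)
    (hns : HyperellipticReduction.NonSpecial g D)
    (H I : Polynomial ℂ)
    (hH : H = HyperellipticReduction.redH g lam (fun k => (Pt k).x) (fun k => (Pt k).y))
    (hI : I = HyperellipticReduction.redI g lam (fun k => (Pt k).x) (fun k => (Pt k).y)) :
    H.Monic ∧ H.natDegree = g ∧ I.degree < (g : WithBot ℕ) ∧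
    (∃ D' : HyperellipticReduction.Divisor (HyperellipticReduction.curvePoly g lam),
      HyperellipticReduction.IsReductionOf g D D') ∧
    (∀ D' : HyperellipticReduction.Divisor (HyperellipticReduction.curvePoly g lam),
      HyperellipticReduction.IsReductionOf g D D' →
        HyperellipticReduction.DefinedBySystem D' H (-I)) := by 
  have hxy : ∀ k, (Pt k).y ^ 2 = (HyperellipticReduction.curvePoly g lam).eval (Pt k).x :=
    fun k => (Pt k).on_curve
  have hx := HyperellipticReduction.injective_x_of_nonSpecial hD hPt hns
  have hy := HyperellipticReduction.y_ne_zero_of_nonSpecial hD hns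
  have hodd := HyperellipticReduction.odd_natDegree_curvePoly (g := g) hlam
  have hdeg := HyperellipticReduction.natDegree_curvePoly (g := g) hlam
  obtain ⟨hmonic, hnat⟩ := HyperellipticReduction.redH_monic_and_natDegree (lam := lam) hx hlam
    (y := fun k => (Pt k).y) hy hxy
  have hmul := HyperellipticReduction.nodePoly_mul_redH (lam := lam) hx
    (y := fun k => (Pt k).y) hy hxy
  have hIdeg := HyperellipticReduction.degree_redI_lt hmonic hnat
  have hIeq := HyperellipticReduction.redI_eq (lam := lam) (x := fun k => (Pt k).x)
    (y := fun k => (Pt k).y)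
  rw [← hH] at hmonic hnat hmul hIeq
  rw [← hI] at hIdeg hIeq
  have hgraph := HyperellipticReduction.eval_hermite hx (fun k => (Pt k).y)
    (HyperellipticReduction.derivAt g lam (fun k => (Pt k).x) / (2 * (Pt 0).y))
  have hadeg := HyperellipticReduction.natDegree_hermite_le (x := fun k => (Pt k).x)
    (fun k => (Pt k).y)
    (HyperellipticReduction.derivAt g lam (fun k => (Pt k).x) / (2 * (Pt 0).y))
  -- From here on `a` enters only through its values at the nodes, its degree bound, the
  -- factorization of `P - a²` and `I = a - cH`; tangency at `P₁` is encoded in the factorization.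
  generalize HyperellipticReduction.hermite g (fun k => (Pt k).x) (fun k => (Pt k).y)
    (HyperellipticReduction.derivAt g lam (fun k => (Pt k).x) / (2 * (Pt 0).y)) = a at *
  rw [← HyperellipticReduction.xPoly_doubled hD] at hmul
  have hDgraph : ∀ R ∈ D, R.y = a.eval R.x := by
    intro R hR
    have : ∃ k, Pt k = R := by
      rw [hD] at hR
      simp only [Multiset.mem_add, Multiset.insert_eq_cons, Multiset.mem_cons,
        Multiset.mem_singleton, Multiset.mem_map] at hR
      rcases hR with (h | h) | ⟨k, -, h⟩
      · exact ⟨0, h.symm⟩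
      · exact ⟨0, h.symm⟩
      · exact ⟨k, h⟩
    obtain ⟨k, rfl⟩ := this
    exact (hgraph k).symm
  -- The residual points are taken on `y = -a`: the intersections of the graph of `a` with the curve
  -- outside `D` must be reflected.
  obtain ⟨M, hM, rfl⟩ := HyperellipticReduction.exists_points_on_graph (a := -a) hmonic
    (Dvd.intro_left _ (by rw [neg_sq]; exact hmul))
  have hMcard : Multiset.card M = g := by
    rw [← HyperellipticReduction.natDegree_xPoly, hnat]
  have hDcard := HyperellipticReduction.card_doubled hD
  refine ⟨hmonic, hnat, hIdeg, ⟨HyperellipticReduction.toDivisor M,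
    HyperellipticReduction.isReductionOf_graph hodd hsq hdeg hadeg hDcard hMcard hDgraph hM
      hmul⟩, fun D' hD' => ?_⟩
  rw [HyperellipticReduction.eq_toDivisor_of_isReductionOf hodd hsq hdeg hadeg hDcard hDgraph hM
    hmul (HyperellipticReduction.not_pair_le hD hns) hD', hIeq]
  exact HyperellipticReduction.definedBySystem_graph hodd hsq hDgraph hM hmul _
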